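/- Let $d\ge 1$, let $\Omega\subset\mathbb{R}^d$ be a bounded open set (for instance a bounded Lipschitz domain), and let $k\in\mathbb{C}$, where $k\neq 0$ if $d\in\{1,2\}$. Let $G_k$ be the outgoing fundamental solution of the Helmholtz equation, $(\Delta+k^2)G_k=-\delta$ in $\mathbb{R}^d$. For $d\ge2$ it is given by $$G_k(x)=\frac{e^{ik|x|}}{2(2\pi)^{(d-1)/2}\,\Gamma(\frac{d-1}{2})}\int_0^\infty e^{-|x|s}\,s^{\frac{d-3}{2}}\Big(\frac s2-ik\Big)^{\frac{d-3}{2}}ds$$ with principal powers, which for $k\ne0$, $\operatorname{Im}k\ge0$ is $\frac i4\big(\frac{k}{2\pi|x|}\big)^{\frac{d-2}{2}}H^{(1)}_{\frac{d-2}{2}}(k|x|)$, and for $d=3$ and all $k$ is $\frac{e^{ik|x|}}{4\pi|x|}$; for $d=1$, $G_k(x)=\frac{i}{2k}e^{ik|x|}$. (For $\operatorname{Im}k<0$, $G_k$ is understood as given by these formulas.) Let $a$ and $k(\cdot)$ be complex-valued functions on $\mathbb{R}^d$ with $a(x)=1$ for almost every $x\in\mathbb{R}^d$, $k(\cdot)\in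 L^\infty(\mathbb{R}^d)$, and $k(x)=k$ for almost every $x\notin\Omega$. Put $\alpha=a-1$, $\beta=k(\cdot)^2-k^2$ and $$Au(x)=\operatorname{div}\int_\Omega G_k(x-y)\,\alpha(y)\,\nabla u(y)\,dy+\int_\Omega G_k(x-y)\,\beta(y)\,u(y)\,dy ,$$ with the divergence in the sense of distributions on $\Omega$. Let $H^1(\Omega)$ be the space of $u\in L^2(\Omega)$ with weak gradient in $L^2(\Omega)^d$. Then: 1. The kernel $K(x,y)=G_k(x-y)\beta(y)$ is weakly singular on $\Omega$: it is measurable, continuous in $x\in\Omega\setminus\{y\}$ for each $y\in\Omega$, and there are $C$ and $\gamma\in(0,d]$ such that, for almost every $y\in\Omega$, $|K(x,y)|\le C|x-y|^{\gamma-d}$ for all $x\in\Omega$, $x\ne y$. 2. For $u\in H^1(\Omega)$ and $f\in L^2(\Omega)$, the volume integral equation $u-Au=f$ holds in the sense of distributions on $\Omega$ if and only if $u$ solves the integral equation of the second kind $$u(x)-\int_\Omega K(x,y)\,u(y)\,dy=f(x)\qquad\text{for almost every }x\in\Omega,$$ with an absolutely convergent integral. 3. $A$ is a bounded operator in $H^1(\Omega)$.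 It extends to a bounded operator in $L^2(\Omega)$, given for every $u\in L^2(\Omega)$ by $Au(x)=\int_\Omega K(x,y)u(y)\,dy$ for almost every $x\in\Omega$, with an absolutely convergent integral. 4. In $L^2(\Omega)$ and in $H^1(\Omega)$, $I-A$ is a Fredholm operator of index zero. 5. In $X=L^2(\Omega)$ and in $X=H^1(\Omega)$ the Fredholm alternative holds: either $I-A$ has a bounded inverse on $X$, or $\ker(I-A)$ and $\{\ell\in X':\ \ell\circ(I-A)=0\}$ have the same finite dimension $n\ge1$, and $u-Au=f$ is solvable in $X$ if and only if $\ell(f)=0$ for all $\ell\in X'$ with $\ell\circ(I-A)=0$. -/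

import Mathlib

open MeasureTheory Set
open scoped ContDiff

noncomputable section

namespace AcousticVIE

/-- Euclidean space `ℝ^d`. -/
abbrev E (d : ℕ) : Type := EuclideanSpace ℝ (Fin d)

/-- The complex Hilbert space `L²(Ω)` (Lebesgue measure on `Ω`). -/
abbrev L2 {d : ℕ} (Ω : Set (E d)) : Type := Lp ℂ 2 (volume.restrict Ω)

/-- Test functions: complex-valued, smooth, with compact support contained in `Ω`. -/
structure IsTest {d : ℕ} (Ω : Set (E d)) (φ : E d → ℂ) : Prop where
  smooth : ContDiff ℝ ∞ φ
  compact : HasCompactSupport φ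
  supp : tsupport φ ⊆ Ω

/-- The partial derivative `∂ᵢ φ`. -/
def partialD {d : ℕ} (i : Fin d) (φ : E d → ℂ) (x : E d) : ℂ :=
  fderiv ℝ φ x (EuclideanSpace.single i 1)

/-- `g = ∂ᵢ u` in the weak (distributional) sense on `Ω`. -/
def IsWeakPartial {d : ℕ} (Ω : Set (E d)) (i : Fin d) (u g : L2 Ω) : Prop :=
  ∀ φ : E d → ℂ, IsTest Ω φ →
    ∫ x in Ω, u x * partialD i φ x = -∫ x in Ω, g x * φ x

theorem integrable_mul_of_continuous {d : ℕ} {Ω : Set (E d)} (u : L2 Ω) {φ : E d → ℂ}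
    (hc : Continuous φ) (hs : HasCompactSupport φ) :
    Integrable (fun x => u x * φ x) (volume.restrict Ω) :=
  MemLp.integrable_mul (p := 2) (q := 2) (Lp.memLp u) (hc.memLp_of_hasCompactSupport hs)

theorem IsTest.continuous_partialD {d : ℕ} {Ω : Set (E d)} {φ : E d → ℂ} (h : IsTest Ω φ)
    (i : Fin d) : Continuous (partialD i φ) :=
  (h.smooth.continuous_fderiv (by simp)).clm_apply continuous_const

theorem IsTest.hasCompactSupport_partialD {d : ℕ} {Ω : Set (E d)} {φ : E d → ℂ}
    (h : IsTest Ω φ) (i : Fin d) : HasCompactSupport (partialD i φ) :=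
  h.compact.fderiv_apply ℝ (EuclideanSpace.single i 1)

theorem IsWeakPartial.add {d : ℕ} {Ω : Set (E d)} {i : Fin d} {u g v h : L2 Ω}
    (H : IsWeakPartial Ω i u g) (K : IsWeakPartial Ω i v h) :
    IsWeakPartial Ω i (u + v) (g + h) := by
  intro φ hφ
  have hc := hφ.continuous_partialD i
  have hs := hφ.hasCompactSupport_partialD i
  have e1 : ∫ x in Ω, (u + v : L2 Ω) x * partialD i φ x
      = ∫ x in Ω, (u x * partialD i φ x + v x * partialD i φ x) := by
    refine integral_congr_ae ?_
    filter_upwards [Lp.coeFn_add u v] with x hx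
    rw [hx, Pi.add_apply, add_mul]
  have e2 : ∫ x in Ω, (g + h : L2 Ω) x * φ x = ∫ x in Ω, (g x * φ x + h x * φ x) := by
    refine integral_congr_ae ?_
    filter_upwards [Lp.coeFn_add g h] with x hx
    rw [hx, Pi.add_apply, add_mul]
  rw [e1, e2, integral_add (integrable_mul_of_continuous u hc hs)
    (integrable_mul_of_continuous v hc hs),
    integral_add (integrable_mul_of_continuous g hφ.smooth.continuous hφ.compact)
    (integrable_mul_of_continuous h hφ.smooth.continuous hφ.compact), H φ hφ, K φ hφ]
  ring

theorem IsWeakPartial.smul {d : ℕ} {Ω : Set (E d)} {i : Fin d} {u g : L2 Ω} (c : ℂ)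
    (H : IsWeakPartial Ω i u g) : IsWeakPartial Ω i (c • u) (c • g) := by
  intro φ hφ
  have e1 : ∫ x in Ω, (c • u : L2 Ω) x * partialD i φ x
      = ∫ x in Ω, c * (u x * partialD i φ x) := by
    refine integral_congr_ae ?_
    filter_upwards [Lp.coeFn_smul c u] with x hx
    rw [hx, Pi.smul_apply, smul_eq_mul, mul_assoc]
  have e2 : ∫ x in Ω, (c • g : L2 Ω) x * φ x = ∫ x in Ω, c * (g x * φ x) := by
    refine integral_congr_ae ?_
    filter_upwards [Lp.coeFn_smul c g] with x hx
    rw [hx, Pi.smul_apply, smul_eq_mul, mul_assoc]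
  rw [e1, e2, integral_const_mul, integral_const_mul, H φ hφ, mul_neg]

theorem IsWeakPartial.zero {d : ℕ} {Ω : Set (E d)} {i : Fin d} :
    IsWeakPartial Ω i (0 : L2 Ω) 0 := by
  intro φ _
  have e (ψ : E d → ℂ) : ∫ x in Ω, (0 : L2 Ω) x * ψ x = 0 := by
    rw [← integral_zero (E d) ℂ (μ := volume.restrict Ω)]
    refine integral_congr_ae ?_
    filter_upwards [Lp.coeFn_zero ℂ 2 (volume.restrict Ω)] with x hx
    rw [hx, Pi.zero_apply, zero_mul]
  rw [e, e, neg_zero]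

/-- The Sobolev space `H¹(Ω)`: the pairs `(u, ∇u)` with `u ∈ L²(Ω)` and weak gradient
`∇u ∈ L²(Ω)^d`, with the norm `(‖u‖² + ∑ᵢ ‖∂ᵢu‖²)^(1/2)`. -/
def H1 {d : ℕ} (Ω : Set (E d)) :
    Submodule ℂ (WithLp 2 (L2 Ω × PiLp 2 (fun _ : Fin d => L2 Ω))) where
  carrier := {p | ∀ i, IsWeakPartial Ω i p.fst (p.snd i)}
  add_mem' hp hq i := (hp i).add (hq i)
  zero_mem' _ := IsWeakPartial.zero
  smul_mem' c _ hp i := (hp i).smul c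

/-- The underlying function `u ∈ L²(Ω)` of an element of `H¹(Ω)`. -/
def fnOf {d : ℕ} {Ω : Set (E d)} (u : H1 Ω) : L2 Ω := u.1.fst

/-- The weak partial derivative `∂ᵢu ∈ L²(Ω)` of an element of `H¹(Ω)`. -/
def gradOf {d : ℕ} {Ω : Set (E d)} (u : H1 Ω) (i : Fin d) : L2 Ω := u.1.snd i

/-- The outgoing fundamental solution `G_k` of the Helmholtz equation in `ℝ^d`,
`(Δ + k²) G_k = -δ`.

For `d ≥ 2`, with `r = |x|`, this is
`G_k(x) = (i/4) (k / (2 π r))^((d-2)/2) H^{(1)}_{(d-2)/2}(k r)`, in which Poisson's integral for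
the Hankel function `H^{(1)}` has been inserted:
`G_k(x) = e^{ikr} / (2 (2π)^((d-1)/2) Γ((d-1)/2)) *
  ∫_0^∞ e^{-rs} s^((d-3)/2) (s/2 - ik)^((d-3)/2) ds`.
It is `e^{ik|x|} / (4π|x|)` for `d = 3`, and for `d ≥ 3` and `k = 0` it is the Newtonian kernel.
For `d = 1` it is `(i/(2k)) e^{ik|x|}`. -/
def helmholtzG (d : ℕ) (k : ℂ) (x : E d) : ℂ :=
  if d = 1 then Complex.I / (2 * k) * Complex.exp (Complex.I * k * ‖x‖)
  else
    Complex.exp (Complex.I * k * ‖x‖) /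
        ((2 * (2 * Real.pi) ^ (((d : ℝ) - 1) / 2) * Real.Gamma (((d : ℝ) - 1) / 2) : ℝ) : ℂ) *
      ∫ s in Ioi (0 : ℝ),
        ((Real.exp (-(‖x‖ * s)) * s ^ (((d : ℝ) - 3) / 2) : ℝ) : ℂ) *
          ((s : ℂ) / 2 - Complex.I * k) ^ (((d : ℂ) - 3) / 2)

/-- The kernel `G_k(x - y) β(y)`, `β = k(·)² - k²`; the variable coefficient `k(·)` is called
`κ` and its constant value outside of the scatterer is called `k`. -/
def vieKernel {d : ℕ} (k : ℂ) (κ : E d → ℂ) (x y : E d) : ℂ :=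
  helmholtzG d k (x - y) * (κ y ^ 2 - k ^ 2)

/-- The distribution `A u = div ∫_Ω G_k(· - y) α(y) ∇u(y) dy + ∫_Ω G_k(· - y) β(y) u(y) dy` on
`Ω`, `α = a - 1`, `β = κ² - k²`, applied to the test function `φ`; the outer divergence is the
distributional one. -/
def vioPairing {d : ℕ} (Ω : Set (E d)) (k : ℂ) (a κ : E d → ℂ) (u : H1 Ω) (φ : E d → ℂ) : ℂ :=
  -(∑ i, ∫ x in Ω, (∫ y in Ω, helmholtzG d k (x - y) * (a y - 1) * gradOf u i y) * partialD i φ x)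
    + ∫ x in Ω, (∫ y in Ω, helmholtzG d k (x - y) * (κ y ^ 2 - k ^ 2) * fnOf u y) * φ x

/-- `u ∈ H¹(Ω)` solves the volume integral equation `u - A u = f` on `Ω`, in the sense of
distributions. -/
def SolvesVIE {d : ℕ} (Ω : Set (E d)) (k : ℂ) (a κ : E d → ℂ) (u : H1 Ω) (f : L2 Ω) : Prop :=
  ∀ φ : E d → ℂ, IsTest Ω φ →
    (∫ x in Ω, fnOf u x * φ x) - vioPairing Ω k a κ u φ = ∫ x in Ω, f x * φ x

/-- `K` is a weakly singular kernel on `Ω`: measurable, continuous in `x` for `x ≠ y`, and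
`|K(x, y)| ≤ C |x - y|^(γ - d)` for some `γ > 0`. (The coefficient enters through `y`, and is only
defined almost everywhere.) -/
def IsWeaklySingularKernel {d : ℕ} (Ω : Set (E d)) (K : E d → E d → ℂ) : Prop :=
  AEStronglyMeasurable (Function.uncurry K)
      ((volume.restrict Ω).prod (volume.restrict Ω)) ∧
    (∀ y ∈ Ω, ContinuousOn (fun x => K x y) (Ω \ {y})) ∧
    ∃ C γ : ℝ, 0 < γ ∧ γ ≤ d ∧
      ∀ᵐ y ∂(volume.restrict Ω), ∀ x ∈ Ω, x ≠ y → ‖K x y‖ ≤ C * ‖x - y‖ ^ (γ - d)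

/-- For functions `u`, `f` on `Ω`: `u(x) - ∫_Ω K(x, y) u(y) dy = f(x)` for almost every `x ∈ Ω`,
with an absolutely convergent integral. -/
def SolvesSecondKind {d : ℕ} (Ω : Set (E d)) (K : E d → E d → ℂ) (u f : L2 Ω) : Prop :=
  ∀ᵐ x ∂(volume.restrict Ω), IntegrableOn (fun y => K x y * u y) Ω volume ∧
    u x - ∫ y in Ω, K x y * u y = f x

section Fredholm

variable {H : Type*} [NormedAddCommGroup H] [NormedSpace ℂ H]

/-- The index `dim ker B - dim coker B` (meaningful for a Fredholm operator `B`). -/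
def fredholmIndex (B : H →L[ℂ] H) : ℤ :=
  (Module.finrank ℂ B.ker : ℤ) - (Module.finrank ℂ (H ⧸ B.range) : ℤ)

/-- The continuous linear functionals `ℓ` with `ℓ ∘ B = 0`: the kernel of the transpose of `B`. -/
def kerTranspose (B : H →L[ℂ] H) : Submodule ℂ (H →L[ℂ] ℂ) where
  carrier := {l | ∀ v, l (B v) = 0}
  add_mem' ha hb v := by simp [ha v, hb v]
  zero_mem' v := by simp
  smul_mem' c l hl v := by simp [hl v]

/-- The Fredholm alternative for the equation `B u = f`: either it is uniquely solvable for
every `f`, with `u` depending continuously on `f`, or the homogeneous equation and the transposed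
homogeneous equation have the same finite number `n ≥ 1` of linearly independent solutions, and
`B u = f` is solvable exactly for those `f` that are annihilated by all solutions of the transposed
homogeneous equation. -/
def FredholmAlternative (B : H →L[ℂ] H) : Prop :=
  B.IsInvertible ∨
    ∃ n : ℕ, 1 ≤ n ∧ Module.finrank ℂ B.ker = n ∧ Module.finrank ℂ (kerTranspose B) = n ∧
      ∀ f, (∃ u, B u = f) ↔ ∀ l ∈ kerTranspose B, l f = 0

end Fredholm

end AcousticVIE

end

open AcousticVIE

/-! Since `a = 1` almost everywhere, the density of the divergence term vanishes, and `A` is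
convolution of `β u` with `G_k`. This kernel is radial, `G_k(x) = g(|x|)`, and `g` and `g'` are both
`O(r^(1-d))` at the origin (`exists_profile_helmholtzG`). The bound on `g` is not sharp, but
`|z|^(1-d)` is locally integrable, which is all that is used.

In `L²(Ω)`, Schur's test bounds the operator by the `L¹` norm of the kernel on a ball. Approximating
the kernel in `L¹` by a continuous one, and that one by a kernel that is piecewise constant in `x`,
brings the operator within `1/2` of an operator `F` of finite rank
(`exists_finiteRange_norm_sub_le`). Hence `1 - A` is an invertible operator minus one of finite
rank, and so Fredholm of index zero.

In `H¹(Ω)`, the bound on `g'` shows that the potential is a bounded map `T : L²(Ω) → H¹(Ω)`, because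
weak derivatives may be taken under the integral (`IsWeaklySingularProfile.isWeakPartial`). With the
inclusion `ι : H¹(Ω) → L²(Ω)`, the operator is `ι T` on `L²` and `T ι` on `H¹`. The operators `1 - ι
T` and `1 - T ι` have isomorphic kernels and cokernels, so the result passes from `L²` to `H¹`. No
compact embedding, and hence no regularity of the boundary, is needed.

The Fredholm alternative follows from index zero and the identification of the kernel of the
transpose with the dual of the cokernel. -/

namespace AcousticVIE

open Filter Topology
open scoped ENNReal NNReal

/-! ### Kernels and cokernels of `1 - T S` and `1 - S T` -/

section Jacobson

variable {K X Y : Type*} [Field K] [AddCommGroup X] [Module K X] [AddCommGroup Y] [Module K Y]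

/-- `ker (1 - T S) ≃ ker (1 - S T)`, induced by `S`. -/
def kerOneSubCompEquiv (S : X →ₗ[K] Y) (T : Y →ₗ[K] X) :
    (LinearMap.id - T ∘ₗ S).ker ≃ₗ[K] (LinearMap.id - S ∘ₗ T).ker :=
  LinearEquiv.ofLinearMap
    (S.restrict (p := (LinearMap.id - T ∘ₗ S).ker) (q := (LinearMap.id - S ∘ₗ T).ker) (by
      intro x hx
      have h : x = T (S x) := by simpa [sub_eq_zero] using hx
      simp [← h]))
    (T.restrict (p := (LinearMap.id - S ∘ₗ T).ker) (q := (LinearMap.id - T ∘ₗ S).ker) (by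
      intro y hy
      have h : y = S (T y) := by simpa [sub_eq_zero] using hy
      simp [← h]))
    (by
      ext ⟨y, hy⟩
      have h : y = S (T y) := by simpa [sub_eq_zero] using hy
      simp [← h])
    (by
      ext ⟨x, hx⟩
      have h : x = T (S x) := by simpa [sub_eq_zero] using hx
      simp [← h])

theorem range_oneSubComp_le_comap (S : X →ₗ[K] Y) (T : Y →ₗ[K] X) :
    (LinearMap.id - T ∘ₗ S).range ≤ (LinearMap.id - S ∘ₗ T).range.comap S := by
  rintro _ ⟨x, rfl⟩
  exact ⟨S x, by simp⟩

theorem mapQ_comp_mapQ_oneSubComp (S : X →ₗ[K] Y) (T : Y →ₗ[K] X) :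
    (Submodule.mapQ _ _ T (range_oneSubComp_le_comap T S)) ∘ₗ
      (Submodule.mapQ _ _ S (range_oneSubComp_le_comap S T)) = LinearMap.id := by
  refine Submodule.linearMap_qext _ (LinearMap.ext fun x => ?_)
  simp only [LinearMap.comp_apply, Submodule.mkQ_apply, Submodule.mapQ_apply, LinearMap.id_apply]
  rw [eq_comm, Submodule.Quotient.eq]
  exact ⟨x, by simp⟩

/-- `coker (1 - T S) ≃ coker (1 - S T)`, induced by `S`. -/
def cokerOneSubCompEquiv (S : X →ₗ[K] Y) (T : Y →ₗ[K] X) :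
    (X ⧸ (LinearMap.id - T ∘ₗ S).range) ≃ₗ[K] (Y ⧸ (LinearMap.id - S ∘ₗ T).range) :=
  LinearEquiv.ofLinearMap
    (Submodule.mapQ _ _ S (range_oneSubComp_le_comap S T))
    (Submodule.mapQ _ _ T (range_oneSubComp_le_comap T S))
    (mapQ_comp_mapQ_oneSubComp T S) (mapQ_comp_mapQ_oneSubComp S T)

theorem finrank_ker_eq_finrank_coker [FiniteDimensional K X] (f : X →ₗ[K] X) :
    Module.finrank K f.ker = Module.finrank K (X ⧸ f.range) := by
  have h1 := f.finrank_range_add_finrank_ker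
  have h2 := f.range.finrank_quotient_add_finrank
  omega

/-- Factoring `f` through its range and swapping the two factors replaces `1 - f` by an endomorphism
of a finite-dimensional space, where rank-nullity applies. -/
theorem finrank_ker_id_sub_eq_of_hasFiniteRange {f : X →ₗ[K] X} (hf : f.HasFiniteRange) :
    Module.finrank K (LinearMap.id - f).ker =
      Module.finrank K (X ⧸ (LinearMap.id - f).range) := by
  have : FiniteDimensional K f.range := Module.Finite.of_fg hf.fg_range
  have e : f = f.range.subtype ∘ₗ f.rangeRestrict := by ext; simp
  have h1 := (kerOneSubCompEquiv f.rangeRestrict f.range.subtype).finrank_eq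
  have h2 := (cokerOneSubCompEquiv f.rangeRestrict f.range.subtype).finrank_eq
  rw [← e] at h1 h2
  rw [h1, h2, finrank_ker_eq_finrank_coker]

end Jacobson

/-! ### Fredholm operators of index zero and the Fredholm alternative -/

section Fredholm

variable {X Y : Type*} [NormedAddCommGroup X] [NormedSpace ℂ X]
  [NormedAddCommGroup Y] [NormedSpace ℂ Y]

-- If `W` inverts `1 - S T` modulo finite rank, then `1 + T W S` does so for `1 - T S`, because `(1
-- + T W S)(1 - T S) - 1 = T (W (1 - S T) - 1) S`, and similarly in the other order.
open LinearMap.FiniteRangeSetoid in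
theorem isFredholm_one_sub_comp_swap {S : X →L[ℂ] Y} {T : Y →L[ℂ] X}
    (h : (1 - S.comp T).IsFredholm) : (1 - T.comp S).IsFredholm := by
  obtain ⟨W, h1, h2⟩ := h.exists_isQuasiInverse
  refine ContinuousLinearMap.IsFredholm.of_isQuasiInverse (v := 1 + T.comp (W.comp S)) ⟨?_, ?_⟩
  · have h1 := equiv_iff_hasNoetherianRange.1 h1
    refine equiv_iff_hasNoetherianRange.2 ?_
    have e : ((1 + T.comp (W.comp S) : X →L[ℂ] X) : X →ₗ[ℂ] X) ∘ₗ
        ((1 - T.comp S : X →L[ℂ] X) : X →ₗ[ℂ] X) - LinearMap.id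
        = ((T : Y →ₗ[ℂ] X) ∘ₗ ((W : Y →ₗ[ℂ] Y) ∘ₗ ((1 - S.comp T : Y →L[ℂ] Y) : Y →ₗ[ℂ] Y)
          - LinearMap.id)) ∘ₗ (S : X →ₗ[ℂ] Y) := by
      ext x
      simp
      abel
    rw [e]
    exact (h1.comp_left (T : Y →ₗ[ℂ] X)).comp_right (S : X →ₗ[ℂ] Y)
  · have h2 := equiv_iff_hasNoetherianRange.1 h2
    refine equiv_iff_hasNoetherianRange.2 ?_
    have e : ((1 - T.comp S : X →L[ℂ] X) : X →ₗ[ℂ] X) ∘ₗ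
        ((1 + T.comp (W.comp S) : X →L[ℂ] X) : X →ₗ[ℂ] X) - LinearMap.id
        = ((T : Y →ₗ[ℂ] X) ∘ₗ (((1 - S.comp T : Y →L[ℂ] Y) : Y →ₗ[ℂ] Y) ∘ₗ (W : Y →ₗ[ℂ] Y)
          - LinearMap.id)) ∘ₗ (S : X →ₗ[ℂ] Y) := by
      ext x
      simp
      abel
    rw [e]
    exact (h2.comp_left (T : Y →ₗ[ℂ] X)).comp_right (S : X →ₗ[ℂ] Y)

theorem fredholmIndex_one_sub_comp_swap (S : X →L[ℂ] Y) (T : Y →L[ℂ] X) :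
    fredholmIndex (1 - T.comp S) = fredholmIndex (1 - S.comp T) := by
  have h1 := (kerOneSubCompEquiv (S : X →ₗ[ℂ] Y) (T : Y →ₗ[ℂ] X)).finrank_eq
  have h2 := (cokerOneSubCompEquiv (S : X →ₗ[ℂ] Y) (T : Y →ₗ[ℂ] X)).finrank_eq
  unfold fredholmIndex
  exact congrArg₂ (fun m n : ℕ => (m : ℤ) - n) h1 h2

open LinearMap.FiniteRangeSetoid in
/-- `1 - (S + F)` with `‖S‖ < 1` and `F` of finite rank is a Fredholm operator of index zero. -/
theorem isFredholm_one_sub_of_norm_lt_one_of_hasFiniteRange [CompleteSpace X]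
    {S F : X →L[ℂ] X} (hS : ‖S‖ < 1) (hF : (F : X →ₗ[ℂ] X).HasFiniteRange) :
    (1 - (S + F)).IsFredholm ∧ fredholmIndex (1 - (S + F)) = 0 := by
  set U := Units.oneSub S hS with hU
  -- With `U = 1 - S`, invertible by the Neumann series, the operator is `U (1 - U⁻¹ F)`. Thus `U⁻¹`
  -- is a quasi-inverse, and the index is that of `1 - U⁻¹ F`.
  have e1 : (1 : X →L[ℂ] X) - (S + F) = U.val * (1 - U.inv * F) := by
    rw [mul_sub, ← mul_assoc, U.val_inv, one_mul, mul_one, hU, Units.val_oneSub, sub_sub]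
  have l1 : U.inv * (1 - (S + F)) = 1 - U.inv * F := by
    rw [e1, ← mul_assoc, U.inv_val, one_mul]
  have l2 : (1 - (S + F)) * U.inv = 1 - F * U.inv := by
    have : (1 : X →L[ℂ] X) - (S + F) = U.val - F := by
      rw [hU, Units.val_oneSub, sub_sub]
    rw [this, sub_mul, U.val_inv]
  constructor
  · refine ContinuousLinearMap.IsFredholm.of_isQuasiInverse (v := U.inv) ⟨?_, ?_⟩
    · refine equiv_iff_hasNoetherianRange.2 ?_
      have e : (U.inv : X →ₗ[ℂ] X) ∘ₗ ((1 - (S + F) : X →L[ℂ] X) : X →ₗ[ℂ] X)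
          - LinearMap.id = -((U.inv : X →ₗ[ℂ] X) ∘ₗ (F : X →ₗ[ℂ] X)) := by
        have : (U.inv : X →ₗ[ℂ] X) ∘ₗ ((1 - (S + F) : X →L[ℂ] X) : X →ₗ[ℂ] X)
            = LinearMap.id - (U.inv : X →ₗ[ℂ] X) ∘ₗ (F : X →ₗ[ℂ] X) :=
          congrArg (fun T : X →L[ℂ] X => (T : X →ₗ[ℂ] X)) l1
        rw [this]
        abel
      rw [e]
      exact (hF.hasNoetherianRange.comp_left (U.inv : X →ₗ[ℂ] X)).neg
    · refine equiv_iff_hasNoetherianRange.2 ?_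
      have e : ((1 - (S + F) : X →L[ℂ] X) : X →ₗ[ℂ] X) ∘ₗ (U.inv : X →ₗ[ℂ] X)
          - LinearMap.id = -((F : X →ₗ[ℂ] X) ∘ₗ (U.inv : X →ₗ[ℂ] X)) := by
        have : ((1 - (S + F) : X →L[ℂ] X) : X →ₗ[ℂ] X) ∘ₗ (U.inv : X →ₗ[ℂ] X)
            = LinearMap.id - (F : X →ₗ[ℂ] X) ∘ₗ (U.inv : X →ₗ[ℂ] X) :=
          congrArg (fun T : X →L[ℂ] X => (T : X →ₗ[ℂ] X)) l2
        rw [this]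
        abel
      rw [e]
      exact (hF.hasNoetherianRange.comp_right (U.inv : X →ₗ[ℂ] X)).neg
  · have hG : ((U.inv * F : X →L[ℂ] X) : X →ₗ[ℂ] X).HasFiniteRange :=
      hF.comp_left (U.inv : X →ₗ[ℂ] X)
    have key := finrank_ker_id_sub_eq_of_hasFiniteRange hG
    set e : X ≃ₗ[ℂ] X := LinearEquiv.ofLinearMap (U.val : X →ₗ[ℂ] X) (U.inv : X →ₗ[ℂ] X)
      (by ext x; exact DFunLike.congr_fun U.val_inv x)
      (by ext x; exact DFunLike.congr_fun U.inv_val x) with he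
    have e2 : ((1 - (S + F) : X →L[ℂ] X) : X →ₗ[ℂ] X)
        = (e : X →ₗ[ℂ] X) ∘ₗ (LinearMap.id - ((U.inv * F : X →L[ℂ] X) : X →ₗ[ℂ] X)) := by
      rw [e1]; rfl
    unfold fredholmIndex
    rw [e2, LinearEquiv.ker_comp, key, sub_eq_zero, Nat.cast_inj]
    exact (Submodule.Quotient.equiv _ _ e (by rw [LinearMap.range_comp])).finrank_eq

/-- Functionals on the cokernel of a Fredholm operator are the kernel of its transpose. -/
def dualCokerEquivKerTranspose {B : X →L[ℂ] X} (hB : B.IsFredholm) :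
    Module.Dual ℂ (X ⧸ B.range) ≃ₗ[ℂ] kerTranspose B :=
  haveI : IsClosed (B.range : Set X) := hB.isClosed_range
  haveI : FiniteDimensional ℂ (X ⧸ B.range) := hB.finite_coker
  { toFun := fun l => ⟨⟨l ∘ₗ B.range.mkQ,
        (LinearMap.continuous_of_finiteDimensional l).comp continuous_quot_mk⟩, fun v => by
          have : B.range.mkQ (B v) = 0 := by simp
          change l (B.range.mkQ (B v)) = 0
          rw [this, map_zero]⟩
    invFun := fun l => B.range.liftQ (l.1 : X →ₗ[ℂ] ℂ) (by
      rintro _ ⟨v, rfl⟩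
      exact l.2 v)
    map_add' := fun _ _ => rfl
    map_smul' := fun _ _ => rfl
    left_inv := fun l => by
      refine Submodule.linearMap_qext _ (LinearMap.ext fun x => ?_)
      rfl
    right_inv := fun l => by
      ext x
      rfl }

theorem fredholmAlternative_of_isFredholm {B : X →L[ℂ] X} (hB : B.IsFredholm)
    (h0 : fredholmIndex B = 0) : FredholmAlternative B := by
  have hfk : FiniteDimensional ℂ B.ker := hB.finite_ker
  have hfc : FiniteDimensional ℂ (X ⧸ B.range) := hB.finite_coker
  have hidx : Module.finrank ℂ B.ker = Module.finrank ℂ (X ⧸ B.range) := by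
    unfold fredholmIndex at h0
    omega
  rcases Nat.eq_zero_or_pos (Module.finrank ℂ B.ker) with hz | hpos
  · left
    have hk : B.ker = ⊥ := Submodule.finrank_eq_zero.1 hz
    have hr : B.range = ⊤ := by
      have : Subsingleton (X ⧸ B.range) := Module.finrank_zero_iff.1 (hidx ▸ hz)
      exact Submodule.Quotient.subsingleton_iff.1 this
    have hinj : Function.Injective B := LinearMap.ker_eq_bot.1 hk
    have hsurj : Function.Surjective B := LinearMap.range_eq_top.1 hr
    -- A Fredholm operator is strict, so a bijective one is a homeomorphism. This gives the bounded
    -- inverse without the open mapping theorem.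
    have hemb : Topology.IsEmbedding B :=
      Topology.isEmbedding_iff_isStrictMap_injective.2 ⟨hB.isStrictMap, hinj⟩
    let e := LinearEquiv.ofBijective (B : X →ₗ[ℂ] X) ⟨hinj, hsurj⟩
    refine ⟨{ e with
      continuous_toFun := B.continuous
      continuous_invFun := ?_ }, ?_⟩
    · rw [hemb.continuous_iff]
      convert continuous_id using 1
      ext y
      exact e.apply_symm_apply y
    · ext x; rfl
  · right
    refine ⟨_, hpos, rfl, ?_, fun f => ?_⟩
    · rw [← (dualCokerEquivKerTranspose hB).finrank_eq, Subspace.dual_finrank_eq, hidx]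
    · constructor
      · rintro ⟨u, rfl⟩ l hl
        exact hl u
      · intro h
        -- Functionals on the cokernel separate points, and each of them comes from the kernel of
        -- the transpose.
        have : B.range.mkQ f = 0 := by
          rw [← Module.forall_dual_apply_eq_zero_iff ℂ]
          intro l
          exact h _ (dualCokerEquivKerTranspose hB l).2
        exact (Submodule.Quotient.mk_eq_zero _).1 this

end Fredholm

/-! ### Schur's test in `L²` -/

section Schur

variable {α : Type*} [MeasurableSpace α] {μ : Measure α}

/-- Cauchy-Schwarz: `(∫ k |u|)² ≤ (∫ k) (∫ k |u|²)`. -/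
theorem lintegral_mul_sq_le {f g : α → ℝ≥0∞} (hf : AEMeasurable f μ) (hg : AEMeasurable g μ) :
    (∫⁻ y, f y * g y ∂μ) ^ 2 ≤ (∫⁻ y, f y ∂μ) * ∫⁻ y, f y * g y ^ 2 ∂μ := by
  have hs (t : ℝ≥0∞) : t ^ (1 / 2 : ℝ) * t ^ (1 / 2 : ℝ) = t := by
    rw [← ENNReal.rpow_add_of_nonneg _ _ (by norm_num) (by norm_num)]
    norm_num
  have hs2 (t : ℝ≥0∞) : (t ^ (1 / 2 : ℝ)) ^ (2 : ℝ) = t := by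
    rw [← ENNReal.rpow_mul]
    norm_num
  have h := ENNReal.lintegral_mul_le_Lp_mul_Lq μ Real.HolderConjugate.two_two
    (f := fun y => f y ^ (1 / 2 : ℝ)) (g := fun y => f y ^ (1 / 2 : ℝ) * g y)
    (hf.pow_const _) ((hf.pow_const _).mul hg)
  have e1 : ∀ y, ((fun y => f y ^ (1 / 2 : ℝ)) * fun y => f y ^ (1 / 2 : ℝ) * g y) y
      = f y * g y := by
    intro y
    simp only [Pi.mul_apply]
    rw [← mul_assoc, hs]
  simp only [e1, hs2, ENNReal.mul_rpow_of_nonneg _ _ (zero_le_two (α := ℝ)),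
    ENNReal.rpow_two] at h
  calc (∫⁻ y, f y * g y ∂μ) ^ 2
      ≤ ((∫⁻ y, f y ∂μ) ^ (1 / 2 : ℝ) * (∫⁻ y, f y * g y ^ 2 ∂μ) ^ (1 / 2 : ℝ)) ^ 2 := by
        gcongr
    _ = _ := by rw [mul_pow, sq, sq, hs, hs]

theorem eLpNorm_two_sq {f : α → ℂ} :
    eLpNorm f 2 μ ^ 2 = ∫⁻ x, ‖f x‖ₑ ^ 2 ∂μ := by
  have := eLpNorm_nnreal_pow_eq_lintegral (μ := μ) (f := f) (p := 2) two_ne_zero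
  simpa using this

variable [SFinite μ] {K : α → α → ℂ} {M : ℝ≥0}

/-- Cauchy-Schwarz applied to `|K|^(1/2) · |K|^(1/2) |u|` yields one factor `M` from the row
integrals. After Tonelli, the column integrals yield the other. -/
theorem lintegral_schur_le (hK : AEStronglyMeasurable (Function.uncurry K) (μ.prod μ))
    (h1 : ∀ᵐ x ∂μ, ∫⁻ y, ‖K x y‖ₑ ∂μ ≤ M) (h2 : ∀ᵐ y ∂μ, ∫⁻ x, ‖K x y‖ₑ ∂μ ≤ M)
    {u : α → ℂ} (hu : AEStronglyMeasurable u μ) :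
    ∫⁻ x, (∫⁻ y, ‖K x y * u y‖ₑ ∂μ) ^ 2 ∂μ ≤ M ^ 2 * ∫⁻ y, ‖u y‖ₑ ^ 2 ∂μ := by
  have hKu : AEMeasurable (Function.uncurry fun x y => ‖K x y‖ₑ * ‖u y‖ₑ ^ 2) (μ.prod μ) :=
    hK.enorm.mul (hu.comp_snd.enorm.pow_const 2)
  calc ∫⁻ x, (∫⁻ y, ‖K x y * u y‖ₑ ∂μ) ^ 2 ∂μ
      ≤ ∫⁻ x, M * ∫⁻ y, ‖K x y‖ₑ * ‖u y‖ₑ ^ 2 ∂μ ∂μ := by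
        refine lintegral_mono_ae ?_
        filter_upwards [h1, hK.prodMk_left] with x hx hm
        simp only [enorm_mul]
        have hm' : AEMeasurable (fun y => ‖K x y‖ₑ) μ := hm.enorm
        exact (lintegral_mul_sq_le hm' hu.enorm).trans (by gcongr)
    _ = M * ∫⁻ y, ∫⁻ x, ‖K x y‖ₑ * ‖u y‖ₑ ^ 2 ∂μ ∂μ := by
        rw [lintegral_const_mul' _ _ ENNReal.coe_ne_top, lintegral_lintegral_swap hKu]
    _ ≤ M * ∫⁻ y, M * ‖u y‖ₑ ^ 2 ∂μ := by
        refine mul_le_mul_right (lintegral_mono_ae ?_) _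
        filter_upwards [h2] with y hy
        rw [lintegral_mul_const' _ _ (by simp)]
        gcongr
    _ = M ^ 2 * ∫⁻ y, ‖u y‖ₑ ^ 2 ∂μ := by
        rw [lintegral_const_mul' _ _ ENNReal.coe_ne_top, ← mul_assoc, sq]

theorem ae_integrable_and_eLpNorm_le_of_schur
    (hK : AEStronglyMeasurable (Function.uncurry K) (μ.prod μ))
    (h1 : ∀ᵐ x ∂μ, ∫⁻ y, ‖K x y‖ₑ ∂μ ≤ M) (h2 : ∀ᵐ y ∂μ, ∫⁻ x, ‖K x y‖ₑ ∂μ ≤ M)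
    {u : α → ℂ} (hu : MemLp u 2 μ) :
    (∀ᵐ x ∂μ, Integrable (fun y => K x y * u y) μ) ∧
      AEStronglyMeasurable (fun x => ∫ y, K x y * u y ∂μ) μ ∧
      eLpNorm (fun x => ∫ y, K x y * u y ∂μ) 2 μ ≤ M * eLpNorm u 2 μ := by
  have hle := lintegral_schur_le hK h1 h2 hu.1
  have hKu : AEStronglyMeasurable (Function.uncurry fun x y => K x y * u y) (μ.prod μ) :=
    hK.mul hu.1.comp_snd
  refine ⟨?_, hKu.integral_prod_right', ?_⟩
  · have hfin : ∫⁻ x, (∫⁻ y, ‖K x y * u y‖ₑ ∂μ) ^ 2 ∂μ ≠ ⊤ := by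
      refine (hle.trans_lt ?_).ne
      rw [← eLpNorm_two_sq]
      exact ENNReal.mul_lt_top (by simp) (ENNReal.pow_lt_top hu.2)
    have hm : AEMeasurable (fun x => (∫⁻ y, ‖K x y * u y‖ₑ ∂μ) ^ 2) μ :=
      hKu.enorm.lintegral_prod_right'.pow_const 2
    filter_upwards [ae_lt_top' hm hfin, hKu.prodMk_left] with x hx hmx
    exact ⟨hmx, by
      by_contra h
      simp only [HasFiniteIntegral, not_lt, top_le_iff] at h
      rw [h] at hx
      simp at hx⟩
  · refine (ENNReal.pow_le_pow_left_iff two_ne_zero).1 ?_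
    rw [eLpNorm_two_sq, mul_pow, eLpNorm_two_sq]
    refine le_trans (lintegral_mono fun x => ?_) hle
    gcongr
    exact enorm_integral_le_lintegral_enorm _

/-- Schur's test: a kernel whose row and column integrals are bounded by `M` defines an integral
operator of norm at most `M` on `L²`. -/
theorem exists_integralOperator (hK : AEStronglyMeasurable (Function.uncurry K) (μ.prod μ))
    (h1 : ∀ᵐ x ∂μ, ∫⁻ y, ‖K x y‖ₑ ∂μ ≤ M) (h2 : ∀ᵐ y ∂μ, ∫⁻ x, ‖K x y‖ₑ ∂μ ≤ M) :
    ∃ T : Lp ℂ 2 μ →L[ℂ] Lp ℂ 2 μ, ‖T‖ ≤ M ∧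
      ∀ u : Lp ℂ 2 μ, ∀ᵐ x ∂μ, Integrable (fun y => K x y * u y) μ ∧
        T u x = ∫ y, K x y * u y ∂μ := by
  have key (u : Lp ℂ 2 μ) := ae_integrable_and_eLpNorm_le_of_schur hK h1 h2 (Lp.memLp u)
  have hmem (u : Lp ℂ 2 μ) : MemLp (fun x => ∫ y, K x y * u y ∂μ) 2 μ :=
    ⟨(key u).2.1, (key u).2.2.trans_lt
      (ENNReal.mul_lt_top ENNReal.coe_lt_top (Lp.memLp u).2)⟩
  let L : Lp ℂ 2 μ →ₗ[ℂ] Lp ℂ 2 μ :=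
    { toFun := fun u => (hmem u).toLp _
      map_add' := fun u v => by
        refine Lp.ext ?_
        filter_upwards [(hmem (u + v)).coeFn_toLp, (hmem u).coeFn_toLp, (hmem v).coeFn_toLp,
          Lp.coeFn_add ((hmem u).toLp _) ((hmem v).toLp _), (key u).1, (key v).1]
          with x e1 e2 e3 e4 i1 i2
        rw [e1, e4, Pi.add_apply, e2, e3, ← integral_add i1 i2]
        refine integral_congr_ae ?_
        filter_upwards [Lp.coeFn_add u v] with y hy
        rw [hy, Pi.add_apply, mul_add]
      map_smul' := fun c u => by
        refine Lp.ext ?_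
        filter_upwards [(hmem (c • u)).coeFn_toLp, (hmem u).coeFn_toLp,
          Lp.coeFn_smul c ((hmem u).toLp _)] with x e1 e2 e3
        rw [e1, RingHom.id_apply, e3, Pi.smul_apply, e2, smul_eq_mul, ← integral_const_mul]
        refine integral_congr_ae ?_
        filter_upwards [Lp.coeFn_smul c u] with y hy
        rw [hy, Pi.smul_apply, smul_eq_mul]
        ring }
  refine ⟨L.mkContinuous M fun u => ?_, LinearMap.mkContinuous_norm_le _ M.2 _, fun u => ?_⟩
  · change ‖(hmem u).toLp _‖ ≤ _
    rw [Lp.norm_toLp, Lp.norm_def, ← ENNReal.coe_toReal M, ← ENNReal.toReal_mul]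
    exact ENNReal.toReal_mono
      (ENNReal.mul_lt_top ENNReal.coe_lt_top (Lp.memLp u).2).ne (key u).2.2
  · filter_upwards [(key u).1, (hmem u).coeFn_toLp] with x hx e
    exact ⟨hx, e⟩

end Schur

/-! ### Convolution operators on `Ω` and their approximation by finite rank -/

theorem hasFiniteRange_of_ae_eq_comp {α ι V : Type*} [MeasurableSpace α] {μ : Measure α}
    [IsFiniteMeasure μ] [AddCommGroup V] [Module ℂ V] [Finite ι] [MeasurableSpace ι]
    [DiscreteMeasurableSpace ι] {g : α → ι} (hg : Measurable g) (F : V →ₗ[ℂ] Lp ℂ 2 μ)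
    (hF : ∀ u, ∃ c : ι → ℂ, F u =ᵐ[μ] fun x => c (g x)) : F.HasFiniteRange := by
  have hmem (c : ι → ℂ) : MemLp (fun x => c (g x)) 2 μ := by
    obtain ⟨C, hC⟩ := (Set.finite_range fun j => ‖c j‖).bddAbove
    exact MemLp.of_bound ((Measurable.of_discrete (f := c)).comp hg).aestronglyMeasurable C
      (ae_of_all _ fun x => hC ⟨g x, rfl⟩)
  let Φ : (ι → ℂ) →ₗ[ℂ] Lp ℂ 2 μ :=
    { toFun := fun c => (hmem c).toLp _
      map_add' := fun c c' => MemLp.toLp_add (hmem c) (hmem c')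
      map_smul' := fun r c => MemLp.toLp_const_smul r (hmem c) }
  have hle : F.range ≤ Φ.range := by
    rintro _ ⟨u, rfl⟩
    obtain ⟨c, hc⟩ := hF u
    exact ⟨c, Lp.ext ((hmem c).coeFn_toLp.trans hc.symm)⟩
  have : IsNoetherian ℂ Φ.range := inferInstance
  exact LinearMap.HasNoetherianRange.hasFiniteRange (isNoetherian_of_le hle)

section Convolution

variable {d : ℕ} {Ω : Set (E d)} {R : ℝ} {N : E d → ℂ} {β : E d → ℂ}

theorem lintegral_sub_left_le (hR : ∀ x ∈ Ω, ∀ y ∈ Ω, ‖x - y‖ < R) (f : E d → ℝ≥0∞)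
    (hΩ : MeasurableSet Ω) {x : E d} (hx : x ∈ Ω) :
    ∫⁻ y in Ω, f (x - y) ≤ ∫⁻ z in Metric.ball 0 R, f z := by
  calc ∫⁻ y in Ω, f (x - y)
      = ∫⁻ y in Ω, (Metric.ball 0 R).indicator f (x - y) := by
        refine setLIntegral_congr_fun hΩ fun y hy => ?_
        rw [indicator_of_mem]
        simpa using hR x hx y hy
    _ ≤ ∫⁻ y, (Metric.ball 0 R).indicator f (x - y) := setLIntegral_le_lintegral _ _
    _ = ∫⁻ z in Metric.ball 0 R, f z := by
        rw [lintegral_sub_left_eq_self, lintegral_indicator Metric.isOpen_ball.measurableSet]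

theorem lintegral_sub_right_le (hR : ∀ x ∈ Ω, ∀ y ∈ Ω, ‖x - y‖ < R) (f : E d → ℝ≥0∞)
    (hΩ : MeasurableSet Ω) {y : E d} (hy : y ∈ Ω) :
    ∫⁻ x in Ω, f (x - y) ≤ ∫⁻ z in Metric.ball 0 R, f z := by
  calc ∫⁻ x in Ω, f (x - y)
      = ∫⁻ x in Ω, (Metric.ball 0 R).indicator f (x - y) := by
        refine setLIntegral_congr_fun hΩ fun x hx => ?_
        rw [indicator_of_mem]
        simpa using hR x hx y hy
    _ ≤ ∫⁻ x, (Metric.ball 0 R).indicator f (x - y) := setLIntegral_le_lintegral _ _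
    _ = ∫⁻ z in Metric.ball 0 R, f z := by
        rw [lintegral_sub_right_eq_self, lintegral_indicator Metric.isOpen_ball.measurableSet]

theorem aestronglyMeasurable_sub_mul (hN : Measurable N)
    (hβ : AEStronglyMeasurable β (volume.restrict Ω)) :
    AEStronglyMeasurable (Function.uncurry fun x y => N (x - y) * β y)
      ((volume.restrict Ω).prod (volume.restrict Ω)) :=
  (hN.comp (measurable_fst.sub measurable_snd)).aestronglyMeasurable.mul hβ.comp_snd

/-- The integral operator with kernel `N(x - y) β(y)`, for a locally integrable `N`. -/
theorem exists_convolutionOperator (hΩ : MeasurableSet Ω)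
    (hR : ∀ x ∈ Ω, ∀ y ∈ Ω, ‖x - y‖ < R) (hN : Measurable N)
    (hβ : AEStronglyMeasurable β (volume.restrict Ω))
    {B M : ℝ≥0} (hB : ∀ᵐ y ∂(volume.restrict Ω), ‖β y‖ₑ ≤ B)
    (hM : B * ∫⁻ z in Metric.ball 0 R, ‖N z‖ₑ ≤ M) :
    ∃ T : L2 Ω →L[ℂ] L2 Ω, ‖T‖ ≤ M ∧
      ∀ u : L2 Ω, ∀ᵐ x ∂(volume.restrict Ω), IntegrableOn (fun y => N (x - y) * β y * u y) Ω ∧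
        T u x = ∫ y in Ω, N (x - y) * β y * u y := by
  refine exists_integralOperator (aestronglyMeasurable_sub_mul hN hβ) ?_ ?_
  · filter_upwards [ae_restrict_mem hΩ] with x hx
    refine le_trans ?_ hM
    calc ∫⁻ y in Ω, ‖N (x - y) * β y‖ₑ ≤ ∫⁻ y in Ω, B * ‖N (x - y)‖ₑ := by
          refine lintegral_mono_ae ?_
          filter_upwards [hB] with y hy
          rw [enorm_mul, mul_comm]
          gcongr
      _ = B * ∫⁻ y in Ω, ‖N (x - y)‖ₑ := lintegral_const_mul' _ _ ENNReal.coe_ne_top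
      _ ≤ _ := by
          exact mul_le_mul_right (lintegral_sub_left_le hR (fun z => ‖N z‖ₑ) hΩ hx) _
  · filter_upwards [ae_restrict_mem hΩ, hB] with y hy hBy
    refine le_trans ?_ hM
    calc ∫⁻ x in Ω, ‖N (x - y) * β y‖ₑ ≤ ∫⁻ x in Ω, B * ‖N (x - y)‖ₑ := by
          refine lintegral_mono fun x => ?_
          rw [enorm_mul, mul_comm]
          gcongr
      _ = B * ∫⁻ x in Ω, ‖N (x - y)‖ₑ := lintegral_const_mul' _ _ ENNReal.coe_ne_top
      _ ≤ _ := by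
          exact mul_le_mul_right (lintegral_sub_right_le hR (fun z => ‖N z‖ₑ) hΩ hy) _

/-- A measurable map with finitely many values that moves the points of a bounded set by less
than `δ`. -/
theorem exists_finite_approx_id (hΩb : Bornology.IsBounded Ω) {δ : ℝ} (hδ : 0 < δ) :
    ∃ (n : ℕ) (g : E d → Fin (n + 1)) (e : Fin (n + 1) → E d), Measurable g ∧
      ∀ x ∈ Ω, dist (e (g x)) x < δ := by
  let e := TopologicalSpace.denseSeq (E d)
  have hcov : closure Ω ⊆ ⋃ i, Metric.ball (e i) δ := by
    intro x _
    obtain ⟨i, hi⟩ := (TopologicalSpace.denseRange_denseSeq (E d)).exists_dist_lt x hδ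
    exact mem_iUnion.2 ⟨i, hi⟩
  obtain ⟨t, ht⟩ := hΩb.isCompact_closure.elim_finite_subcover _
    (fun i => Metric.isOpen_ball) hcov
  let n := t.sup id
  refine ⟨n, fun x => Fin.ofNat (n + 1) (SimpleFunc.nearestPtInd e n x), fun i => e i, ?_, ?_⟩
  · exact (Measurable.of_discrete (f := fun i : ℕ => Fin.ofNat (n + 1) i)).comp
      (SimpleFunc.measurable _)
  · intro x hx
    obtain ⟨i, hi, hxi⟩ := mem_iUnion₂.1 (ht (subset_closure hx))
    have h1 := SimpleFunc.edist_nearestPt_le e x (k := i) (N := n) (Finset.le_sup (f := id) hi)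
    have h2 : ((Fin.ofNat (n + 1) (SimpleFunc.nearestPtInd e n x) : Fin (n + 1)) : ℕ)
        = SimpleFunc.nearestPtInd e n x :=
      Nat.mod_eq_of_lt (Nat.lt_succ_of_le (SimpleFunc.nearestPtInd_le e n x))
    simp only [h2]
    rw [SimpleFunc.nearestPt, SimpleFunc.map_apply, edist_dist, edist_dist] at h1
    refine lt_of_le_of_lt ((ENNReal.ofReal_le_ofReal_iff dist_nonneg).1 h1) ?_
    rw [dist_comm]
    exact hxi

/-- Replacing `x` by a nearby point `e (g x)` of a finite set changes the kernel uniformly little,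
by uniform continuity of `N`. The modified operator yields functions that depend on `x` only through
`g x`, which form a finite-dimensional space. -/
theorem exists_finiteRange_norm_sub_le_of_continuous (hΩ : MeasurableSet Ω)
    (hΩb : Bornology.IsBounded Ω) (hN : Continuous N) (hNs : HasCompactSupport N)
    (hβ : AEStronglyMeasurable β (volume.restrict Ω))
    {B : ℝ≥0} (hB : ∀ᵐ y ∂(volume.restrict Ω), ‖β y‖ₑ ≤ B) {T : L2 Ω →L[ℂ] L2 Ω}
    (hT : ∀ u : L2 Ω, ∀ᵐ x ∂(volume.restrict Ω),
      IntegrableOn (fun y => N (x - y) * β y * u y) Ω ∧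
        T u x = ∫ y in Ω, N (x - y) * β y * u y) {η : ℝ≥0} (hη : 0 < η) :
    ∃ F : L2 Ω →L[ℂ] L2 Ω, (F : L2 Ω →ₗ[ℂ] L2 Ω).HasFiniteRange ∧ ‖T - F‖ ≤ η := by
  have hfin : volume Ω < ⊤ := hΩb.measure_lt_top
  have : IsFiniteMeasure (volume.restrict Ω) := ⟨by simpa using hfin⟩
  obtain ⟨θ, hθ, hθη⟩ : ∃ θ : ℝ≥0, 0 < θ ∧ (θ * B * volume Ω : ℝ≥0∞) ≤ η := by
    lift volume Ω to ℝ≥0 using hfin.ne with m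
    -- The `+ 1` keeps the denominator positive when `B` or the measure of `Ω` vanishes.
    refine ⟨η / (B * m + 1), by positivity, ?_⟩
    norm_cast
    rw [mul_assoc, div_mul_eq_mul_div]
    refine div_le_of_le_mul₀ (by positivity) (by positivity) ?_
    gcongr
    simp
  obtain ⟨δ, hδ, hNδ⟩ := Metric.uniformContinuous_iff.1
    (hNs.uniformContinuous_of_continuous hN) θ hθ
  obtain ⟨n, g, e, hg, hge⟩ := exists_finite_approx_id hΩb hδ
  have heg : Measurable fun x => e (g x) := (Measurable.of_discrete (f := e)).comp hg
  have hclose : ∀ x ∈ Ω, ∀ y, ‖N (x - y) - N (e (g x) - y)‖ₑ ≤ θ := by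
    intro x hx y
    have := hNδ (a := x - y) (b := e (g x) - y) (by
      rw [dist_sub_right, dist_comm]
      exact hge x hx)
    rw [dist_eq_norm] at this
    rw [enorm_le_coe]
    exact_mod_cast this.le
  let D : E d → E d → ℂ := fun x y => (N (x - y) - N (e (g x) - y)) * β y
  have hDm : AEStronglyMeasurable (Function.uncurry D)
      ((volume.restrict Ω).prod (volume.restrict Ω)) := by
    refine AEStronglyMeasurable.mul (Measurable.aestronglyMeasurable ?_) hβ.comp_snd
    exact (hN.measurable.comp (measurable_fst.sub measurable_snd)).sub
      (hN.measurable.comp ((heg.comp measurable_fst).sub measurable_snd))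
  have hDb : ∀ x ∈ Ω, ∀ y, ‖β y‖ₑ ≤ B → ‖D x y‖ₑ ≤ θ * B := by
    intro x hx y hy
    rw [enorm_mul]
    exact mul_le_mul' (hclose x hx y) hy
  obtain ⟨S, hS, hSu⟩ := exists_integralOperator (M := η) hDm (by
      filter_upwards [ae_restrict_mem hΩ] with x hx
      refine le_trans ?_ hθη
      rw [← setLIntegral_const]
      refine lintegral_mono_ae ?_
      filter_upwards [hB] with y hy using hDb x hx y hy) (by
      filter_upwards [hB] with y hy
      refine le_trans ?_ hθη
      rw [← setLIntegral_const]
      refine lintegral_mono_ae ?_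
      filter_upwards [ae_restrict_mem hΩ] with x hx using hDb x hx y hy)
  refine ⟨T - S, ?_, by simpa using hS⟩
  refine hasFiniteRange_of_ae_eq_comp hg _ fun u =>
    ⟨fun j => ∫ y in Ω, N (e j - y) * β y * u y, ?_⟩
  filter_upwards [hT u, hSu u, Lp.coeFn_sub (T u) (S u)] with x h1 h2 h3
  simp only [ContinuousLinearMap.coe_coe, sub_apply]
  rw [h3, Pi.sub_apply, h1.2, h2.2, ← integral_sub h1.1 h2.1]
  refine integral_congr_ae (ae_of_all _ fun y => ?_)
  simp only [D]
  ring

/-- Integral operators with locally integrable convolution kernels are limits of operators of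
finite rank. -/
theorem exists_finiteRange_norm_sub_le (hΩ : MeasurableSet Ω)
    (hΩb : Bornology.IsBounded Ω) (hR : ∀ x ∈ Ω, ∀ y ∈ Ω, ‖x - y‖ < R) (hN : Measurable N)
    (hNi : IntegrableOn N (Metric.ball 0 R))
    (hβ : AEStronglyMeasurable β (volume.restrict Ω))
    {B : ℝ≥0} (hB : ∀ᵐ y ∂(volume.restrict Ω), ‖β y‖ₑ ≤ B) {T : L2 Ω →L[ℂ] L2 Ω}
    (hT : ∀ u : L2 Ω, ∀ᵐ x ∂(volume.restrict Ω),
      IntegrableOn (fun y => N (x - y) * β y * u y) Ω ∧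
        T u x = ∫ y in Ω, N (x - y) * β y * u y) {η : ℝ≥0} (hη : 0 < η) :
    ∃ F : L2 Ω →L[ℂ] L2 Ω, (F : L2 Ω →ₗ[ℂ] L2 Ω).HasFiniteRange ∧ ‖T - F‖ ≤ η := by
  have hmb : MeasurableSet (Metric.ball (0 : E d) R) := Metric.isOpen_ball.measurableSet
  obtain ⟨θ, hθ, hθη⟩ : ∃ θ : ℝ≥0, 0 < θ ∧ B * θ ≤ η / 2 := by
    refine ⟨η / 2 / (B + 1), by positivity, ?_⟩
    rw [mul_div_assoc']
    refine div_le_of_le_mul₀ (by positivity) (by positivity) ?_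
    rw [mul_comm]
    gcongr
    simp
  -- Only the values of `N` on the ball matter. Its cutoff is integrable and so `L¹`-close to a
  -- continuous `N'` of compact support. The error `N - N'` costs `η / 2` by Schur's test, and `N'`
  -- costs another `η / 2`.
  obtain ⟨N', hNs', hle, hNc', -⟩ := (hNi.integrable_indicator hmb
    ).exists_hasCompactSupport_lintegral_sub_le (ε := θ) (by exact_mod_cast hθ.ne')
  have hle' : ∫⁻ z in Metric.ball 0 R, ‖N z - N' z‖ₑ ≤ θ := by
    refine le_trans ?_ hle
    refine le_trans (le_of_eq ?_) (setLIntegral_le_lintegral (Metric.ball 0 R) _)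
    refine setLIntegral_congr_fun hmb fun z hz => ?_
    simp only [indicator_of_mem hz]
  obtain ⟨S, hS, hSu⟩ := exists_convolutionOperator hΩ hR (hN.sub hNc'.measurable) hβ hB
    (M := η / 2) (by
      refine le_trans (mul_le_mul_right hle' _) ?_
      exact_mod_cast hθη)
  obtain ⟨F, hF, hFle⟩ := exists_finiteRange_norm_sub_le_of_continuous hΩ hΩb hNc' hNs' hβ hB
    (T := T - S) (η := η / 2) (fun u => by
      filter_upwards [hT u, hSu u, Lp.coeFn_sub (T u) (S u)] with x h1 h2 h3
      have e : (fun y => N' (x - y) * β y * u y)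
          = fun y => N (x - y) * β y * u y - (N - N') (x - y) * β y * u y := by
        ext y
        simp only [Pi.sub_apply]
        ring
      rw [sub_apply, h3, Pi.sub_apply, h1.2, h2.2, ← integral_sub h1.1 h2.1, e]
      exact ⟨h1.1.sub h2.1, rfl⟩) (by positivity)
  refine ⟨F, hF, ?_⟩
  calc ‖T - F‖ = ‖S + (T - S - F)‖ := by congr 1; abel
    _ ≤ (η / 2 : ℝ≥0) + (η / 2 : ℝ≥0) := (norm_add_le _ _).trans (add_le_add hS hFle)
    _ = η := by push_cast; ring

end Convolution

/-! ### Weakly singular radial functions -/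

/-- A radial profile `g` on `(0, ∞)` with derivative `g'`, both `O(r^(1-d))` at `0`. -/
structure IsWeaklySingularProfile (d : ℕ) (g g' : ℝ → ℂ) : Prop where
  hasDerivAt : ∀ r, 0 < r → HasDerivAt g (g' r) r
  continuousOn_deriv : ContinuousOn g' (Ioi 0)
  bound : ∀ R : ℝ, ∃ C : ℝ, 0 ≤ C ∧ ∀ r, 0 < r → r ≤ R →
    ‖g r‖ ≤ C * r ^ (1 - d : ℝ) ∧ ‖g' r‖ ≤ C * r ^ (1 - d : ℝ)

/-- The `i`-th partial derivative of `z ↦ g ‖z‖` away from the origin, where `g'` is the derivative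
of `g`. -/
noncomputable def radialPartial {d : ℕ} (g' : ℝ → ℂ) (i : Fin d) (z : E d) : ℂ :=
  g' ‖z‖ * ((z i / ‖z‖ : ℝ) : ℂ)

section Radial

variable {d : ℕ} {g g' : ℝ → ℂ}

theorem norm_coord_div_le (i : Fin d) (z : E d) {r : ℝ} (hr : ‖z‖ ≤ r) :
    ‖((z i / r : ℝ) : ℂ)‖ ≤ 1 := by
  rw [Complex.norm_real, norm_div, Real.norm_of_nonneg ((norm_nonneg z).trans hr)]
  exact div_le_one_of_le₀ ((PiLp.norm_apply_le z i).trans hr) ((norm_nonneg z).trans hr)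

namespace IsWeaklySingularProfile

variable (h : IsWeaklySingularProfile d g g')
include h

theorem continuousOn : ContinuousOn g (Ioi 0) := fun r hr =>
  (h.hasDerivAt r hr).continuousAt.continuousWithinAt

theorem continuousOn_radial : ContinuousOn (fun z : E d => g ‖z‖) {0}ᶜ :=
  h.continuousOn.comp continuous_norm.continuousOn fun _ hz => norm_pos_iff.2 hz

theorem measurable_radial : Measurable fun z : E d => g ‖z‖ :=
  measurable_of_continuousOn_compl_singleton 0 h.continuousOn_radial

theorem measurable_radialPartial (i : Fin d) : Measurable (radialPartial (d := d) g' i) := by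
  refine measurable_of_continuousOn_compl_singleton 0 ?_
  refine ContinuousOn.mul (h.continuousOn_deriv.comp continuous_norm.continuousOn
    fun _ hz => norm_pos_iff.2 hz) ?_
  refine Complex.continuous_ofReal.comp_continuousOn (ContinuousOn.div ?_
    continuous_norm.continuousOn fun _ hz => norm_ne_zero_iff.2 hz)
  exact (EuclideanSpace.proj (𝕜 := ℝ) i).continuous.continuousOn

omit h in
theorem norm_radialPartial_le (i : Fin d) (z : E d) : ‖radialPartial g' i z‖ ≤ ‖g' ‖z‖‖ := by
  rw [radialPartial, norm_mul]
  exact mul_le_of_le_one_right (norm_nonneg _) (norm_coord_div_le i z le_rfl)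

end IsWeaklySingularProfile

end Radial

section Integrability

variable {d : ℕ}
variable {N : E d → ℂ} {C R : ℝ}

theorem nontrivial_of_one_le (hd : 1 ≤ d) : Nontrivial (E d) := by
  apply Module.nontrivial_of_finrank_pos (R := ℝ)
  rw [finrank_euclideanSpace_fin]
  omega

theorem ae_ne_zero (hd : 1 ≤ d) : ∀ᵐ z : E d, z ≠ 0 := by
  have := nontrivial_of_one_le hd
  exact Measure.ae_ne volume 0

/-- The singularity has order `d - 1`, which is below the dimension. -/
theorem integrableOn_ball_of_norm_le (hd : 1 ≤ d) (hN : AEStronglyMeasurable N volume)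
    (hb : ∀ z : E d, z ≠ 0 → ‖z‖ < R → ‖N z‖ ≤ C * ‖z‖ ^ (1 - d : ℝ)) :
    IntegrableOn N (Metric.ball 0 R) := by
  refine integrableOn_ball_of_norm_le_rpow (C := C) (α := (d : ℝ) - 1) ?_ ?_ ?_ hN
  · rw [finrank_euclideanSpace_fin]; exact hd
  · rw [finrank_euclideanSpace_fin]; linarith
  · filter_upwards [ae_restrict_mem Metric.isOpen_ball.measurableSet,
      ae_restrict_of_ae (ae_ne_zero hd)] with z hz hz0
    rw [neg_sub]
    exact hb z hz0 (by simpa using hz)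

theorem integrable_mul_of_integrableOn_ball {ψ : E d → ℂ} (hN : IntegrableOn N (Metric.ball 0 R))
    (hψ : Continuous ψ) (hs : HasCompactSupport ψ) (hR : ∀ z, ψ z ≠ 0 → ‖z‖ < R) :
    Integrable (fun z => N z * ψ z) := by
  obtain ⟨D, hD⟩ := hs.exists_bound_of_continuous hψ
  rw [← integrableOn_iff_integrable_of_support_subset (s := Metric.ball 0 R)]
  · exact Integrable.mul_bdd hN hψ.aestronglyMeasurable (ae_of_all _ hD)
  · intro z hz
    simpa using hR z (right_ne_zero_of_mul hz)

theorem tendsto_integral_mul_of_norm_le (hd : 1 ≤ d) {P : ℕ → E d → ℂ} {ψ : E d → ℂ}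
    (hP : ∀ n, AEStronglyMeasurable (P n) volume)
    (hb : ∀ n, ∀ z : E d, z ≠ 0 → ‖z‖ < R → ‖P n z‖ ≤ C * ‖z‖ ^ (1 - d : ℝ))
    (hlim : ∀ z : E d, z ≠ 0 → Tendsto (fun n => P n z) atTop (𝓝 (N z)))
    (hψ : Continuous ψ) (hs : HasCompactSupport ψ) (hR : ∀ z, ψ z ≠ 0 → ‖z‖ < R) :
    Tendsto (fun n => ∫ z, P n z * ψ z) atTop (𝓝 (∫ z, N z * ψ z)) := by
  have hW : IntegrableOn (fun z : E d => ((C * ‖z‖ ^ (1 - d : ℝ) : ℝ) : ℂ))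
      (Metric.ball 0 R) := by
    refine integrableOn_ball_of_norm_le (C := |C|) hd ?_ fun z _ _ => ?_
    · exact (Complex.measurable_ofReal.comp
        ((measurable_norm.pow_const _).const_mul C)).aestronglyMeasurable
    · rw [Complex.norm_real, norm_mul, Real.norm_eq_abs C,
        Real.norm_of_nonneg (Real.rpow_nonneg (norm_nonneg _) _)]
  refine tendsto_integral_of_dominated_convergence _
    (fun n => (hP n).mul hψ.aestronglyMeasurable)
    (integrable_mul_of_integrableOn_ball hW hψ hs hR).norm (fun n => ?_) ?_
  · filter_upwards [ae_ne_zero hd] with z hz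
    by_cases h0 : ψ z = 0
    · simp [h0]
    · rw [norm_mul, norm_mul]
      gcongr
      refine (hb n z hz (hR z h0)).trans ?_
      rw [Complex.norm_real]
      exact Real.le_norm_self _
  · filter_upwards [ae_ne_zero hd] with z hz
    exact (hlim z hz).mul_const _

end Integrability

/-! ### Weak derivatives of radial functions, by smoothing the norm -/

section Regularization

variable {d : ℕ} {g g' : ℝ → ℂ}

/-- `(‖z‖² + ε²)^(1/2)`. -/
noncomputable def regNorm (ε : ℝ) (z : E d) : ℝ := Real.sqrt (‖z‖ ^ 2 + ε ^ 2)

theorem regNorm_pos {ε : ℝ} (hε : 0 < ε) (z : E d) : 0 < regNorm ε z :=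
  Real.sqrt_pos.2 (by positivity)

theorem norm_le_regNorm (ε : ℝ) (z : E d) : ‖z‖ ≤ regNorm ε z :=
  Real.le_sqrt_of_sq_le (by nlinarith [sq_nonneg ε])

theorem regNorm_le {ε : ℝ} (hε : 0 ≤ ε) (z : E d) : regNorm ε z ≤ ‖z‖ + ε :=
  Real.sqrt_le_iff.2 ⟨by positivity, by nlinarith [norm_nonneg z, mul_nonneg (norm_nonneg z) hε]⟩

theorem continuous_regNorm (ε : ℝ) : Continuous (regNorm (d := d) ε) := by
  unfold regNorm
  fun_prop

theorem tendsto_regNorm (z : E d) :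
    Tendsto (fun n : ℕ => regNorm (1 / ((n : ℝ) + 1)) z) atTop (𝓝 ‖z‖) := by
  have h : Continuous fun ε : ℝ => regNorm ε z := by
    unfold regNorm
    fun_prop
  have h0 : regNorm 0 z = ‖z‖ := by
    rw [regNorm]
    simp
  rw [← h0]
  exact (h.tendsto 0).comp tendsto_one_div_add_atTop_nhds_zero_nat

theorem hasFDerivAt_regNorm {ε : ℝ} (hε : 0 < ε) (z : E d) :
    HasFDerivAt (regNorm ε) ((1 / regNorm ε z) • innerSL ℝ z) z := by
  have h1 : HasFDerivAt (fun z : E d => ‖z‖ ^ 2 + ε ^ 2) (2 • innerSL ℝ z) z :=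
    ((hasStrictFDerivAt_norm_sq z).hasFDerivAt).add_const _
  have h2 := h1.sqrt (by positivity)
  have e : (1 / regNorm ε z) • innerSL ℝ z
      = (1 / (2 * Real.sqrt (‖z‖ ^ 2 + ε ^ 2))) • (2 • innerSL ℝ z) := by
    rw [← Nat.cast_smul_eq_nsmul ℝ, smul_smul, regNorm]
    congr 1
    push_cast
    field_simp
  rw [e]
  exact h2

variable (h : IsWeaklySingularProfile d g g')
include h

theorem IsWeaklySingularProfile.hasFDerivAt_regNorm {ε : ℝ} (hε : 0 < ε) (z : E d) :
    DifferentiableAt ℝ (fun z : E d => g (regNorm ε z)) z ∧ ∀ i,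
      fderiv ℝ (fun z : E d => g (regNorm ε z)) z (EuclideanSpace.single i 1)
        = g' (regNorm ε z) * ((z i / regNorm ε z : ℝ) : ℂ) := by
  have h1 := (h.hasDerivAt _ (regNorm_pos hε z)).hasFDerivAt.comp z
    (AcousticVIE.hasFDerivAt_regNorm hε z)
  refine ⟨h1.differentiableAt, fun i => ?_⟩
  have h2 : HasFDerivAt (fun z : E d => g (regNorm ε z)) _ z := h1
  rw [h2.fderiv]
  simp [EuclideanSpace.inner_single_right]
  ring

/-- The weak derivative of a weakly singular radial function is its pointwise derivative. -/
theorem IsWeaklySingularProfile.integral_mul_partialD (hd : 1 ≤ d) (i : Fin d) {ψ : E d → ℂ}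
    (hψ : IsTest univ ψ) :
    ∫ z, g ‖z‖ * partialD i ψ z = -∫ z, radialPartial g' i z * ψ z := by
  obtain ⟨R, hR⟩ : ∃ R : ℝ, ∀ z ∈ tsupport ψ, ‖z‖ < R := by
    obtain ⟨R, -, hR⟩ := hψ.compact.isCompact.isBounded.exists_pos_norm_lt
    exact ⟨R, hR⟩
  have hRψ : ∀ z, ψ z ≠ 0 → ‖z‖ < R := fun z hz => hR z (subset_tsupport _ hz)
  have hRD : ∀ z, partialD i ψ z ≠ 0 → ‖z‖ < R := fun z hz => hR z (by
    by_contra hn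
    apply hz
    have := support_fderiv_subset ℝ (f := ψ)
    rw [partialD, Function.notMem_support.1 fun hh => hn (this hh)]
    rfl)
  -- The regularized norm with `ε ≤ 1` may exceed `R`, but not `R + 1`.
  obtain ⟨C, hC, hb⟩ := h.bound (R + 1)
  let ε : ℕ → ℝ := fun n => 1 / ((n : ℝ) + 1)
  have hε : ∀ n, 0 < ε n := fun n => by positivity
  have hε1 : ∀ n, ε n ≤ 1 := fun n => by
    simp only [ε]
    rw [div_le_one (by positivity)]
    linarith [Nat.cast_nonneg (α := ℝ) n]
  -- The regularized norm is at least `‖z‖` and the exponent `1 - d` is nonpositive, so the bound at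
  -- `‖z‖` serves for all `n`. It is the dominating function in both limits below.
  have hbn : ∀ n, ∀ z : E d, z ≠ 0 → ‖z‖ < R →
      ‖g (regNorm (ε n) z)‖ ≤ C * ‖z‖ ^ (1 - d : ℝ) ∧
      ‖g' (regNorm (ε n) z)‖ ≤ C * ‖z‖ ^ (1 - d : ℝ) := by
    intro n z hz hzR
    have h1 := hb _ (regNorm_pos (hε n) z) ((regNorm_le (hε n).le z).trans (by linarith [hε1 n]))
    have h2 : C * regNorm (ε n) z ^ (1 - d : ℝ) ≤ C * ‖z‖ ^ (1 - d : ℝ) := by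
      gcongr 1
      refine Real.rpow_le_rpow_of_nonpos (norm_pos_iff.2 hz) (norm_le_regNorm _ z) ?_
      rw [sub_nonpos]
      exact_mod_cast hd
    exact ⟨h1.1.trans h2, h1.2.trans h2⟩
  let P : ℕ → E d → ℂ := fun n z => g (regNorm (ε n) z)
  let Q : ℕ → E d → ℂ := fun n z => g' (regNorm (ε n) z) * ((z i / regNorm (ε n) z : ℝ) : ℂ)
  have hPc : ∀ n, Continuous (P n) := fun n => by
    rw [continuous_iff_continuousAt]
    exact fun z => (h.hasFDerivAt_regNorm (hε n) z).1.continuousAt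
  have hQc : ∀ n, Continuous (Q n) := fun n => by
    refine Continuous.mul ?_ (Complex.continuous_ofReal.comp (Continuous.div ?_
      (continuous_regNorm _) fun z => (regNorm_pos (hε n) z).ne'))
    · exact h.continuousOn_deriv.comp_continuous (continuous_regNorm _)
        fun z => regNorm_pos (hε n) z
    · exact (EuclideanSpace.proj (𝕜 := ℝ) i).continuous
  have hQb : ∀ n, ∀ z : E d, z ≠ 0 → ‖z‖ < R → ‖Q n z‖ ≤ C * ‖z‖ ^ (1 - d : ℝ) := by
    intro n z hz hzR
    refine le_trans ?_ (hbn n z hz hzR).2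
    rw [norm_mul]
    exact mul_le_of_le_one_right (norm_nonneg _) (norm_coord_div_le i z (norm_le_regNorm _ z))
  have hDc := hψ.continuous_partialD i
  have hDs := hψ.hasCompactSupport_partialD i
  -- For `ε > 0` the function `P n` is differentiable everywhere, including the origin, so the
  -- classical integration by parts applies.
  have hibp : ∀ n, ∫ z, P n z * partialD i ψ z = -∫ z, Q n z * ψ z := by
    intro n
    have hfd : ∀ z, fderiv ℝ (P n) z (EuclideanSpace.single i 1) = Q n z :=
      fun z => (h.hasFDerivAt_regNorm (hε n) z).2 i
    have key := integral_mul_fderiv_eq_neg_fderiv_mul_of_integrable (μ := volume)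
      (f := P n) (g := ψ) (v := EuclideanSpace.single i (1 : ℝ))
      (by
        simp only [hfd]
        exact ((hQc n).mul hψ.smooth.continuous).integrable_of_hasCompactSupport
          hψ.compact.mul_left)
      (((hPc n).mul hDc).integrable_of_hasCompactSupport hDs.mul_left)
      (((hPc n).mul hψ.smooth.continuous).integrable_of_hasCompactSupport hψ.compact.mul_left)
      (fun z _ => (h.hasFDerivAt_regNorm (hε n) z).1)
      (fun z _ => (hψ.smooth.differentiable (by simp)) z)
    simp only [hfd] at key
    exact key
  have hl1 : Tendsto (fun n => ∫ z, P n z * partialD i ψ z) atTop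
      (𝓝 (∫ z, g ‖z‖ * partialD i ψ z)) := by
    refine tendsto_integral_mul_of_norm_le (C := C) hd (fun n => (hPc n).aestronglyMeasurable)
      (fun n z hz hzR => (hbn n z hz hzR).1) (fun z hz => ?_) hDc hDs hRD
    exact ((h.hasDerivAt _ (norm_pos_iff.2 hz)).continuousAt.tendsto).comp (tendsto_regNorm z)
  have hl2 : Tendsto (fun n => ∫ z, Q n z * ψ z) atTop
      (𝓝 (∫ z, radialPartial g' i z * ψ z)) := by
    refine tendsto_integral_mul_of_norm_le (C := C) hd (fun n => (hQc n).aestronglyMeasurable)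
      hQb (fun z hz => ?_) hψ.smooth.continuous hψ.compact hRψ
    have hz' := norm_pos_iff.2 hz
    refine Tendsto.mul (((h.continuousOn_deriv.continuousAt (Ioi_mem_nhds hz')).tendsto).comp
      (tendsto_regNorm z)) ?_
    exact (Complex.continuous_ofReal.tendsto _).comp
      (tendsto_const_nhds.div (tendsto_regNorm z) hz'.ne')
  simp only [hibp] at hl1
  exact tendsto_nhds_unique hl1 hl2.neg

theorem IsWeaklySingularProfile.integral_sub_mul_partialD (hd : 1 ≤ d) (i : Fin d) {φ : E d → ℂ}
    (hφ : IsTest univ φ) (y : E d) :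
    ∫ x, g ‖x - y‖ * partialD i φ x = -∫ x, radialPartial g' i (x - y) * φ x := by
  have hψ : IsTest univ fun z => φ (z + y) :=
    { smooth := hφ.smooth.comp (contDiff_id.add contDiff_const)
      compact := hφ.compact.comp_homeomorph (Homeomorph.addRight y)
      supp := subset_univ _ }
  have key := h.integral_mul_partialD hd i hψ
  have hD : ∀ z, partialD i (fun z => φ (z + y)) z = partialD i φ (z + y) := fun z => by
    simp only [partialD, fderiv_comp_add_right]
  simp only [hD] at key
  rw [← integral_add_right_eq_self (fun x => g ‖x - y‖ * partialD i φ x) y,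
    ← integral_add_right_eq_self (fun x => radialPartial g' i (x - y) * φ x) y]
  simpa only [add_sub_cancel_right] using key

end Regularization

theorem IsTest.eq_zero {d : ℕ} {Ω : Set (E d)} {φ : E d → ℂ} (h : IsTest Ω φ) {x : E d}
    (hx : x ∉ Ω) : φ x = 0 :=
  image_eq_zero_of_notMem_tsupport fun hh => hx (h.supp hh)

theorem IsTest.partialD_eq_zero {d : ℕ} {Ω : Set (E d)} {φ : E d → ℂ} (h : IsTest Ω φ)
    (i : Fin d) {x : E d} (hx : x ∉ Ω) : partialD i φ x = 0 := by
  have := support_fderiv_subset ℝ (f := φ)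
  rw [partialD, Function.notMem_support.1 fun hh => hx (h.supp (this hh))]
  rfl

/-! ### Potentials as maps from `L²(Ω)` to `H¹(Ω)` -/

section Fubini

variable {d : ℕ} {Ω : Set (E d)} {R : ℝ} {N : E d → ℂ}

/-- Fubini applies since `φ` is bounded, `w` is integrable, and the integral of `|N(x - y)|` over `x
∈ Ω` is bounded uniformly in `y ∈ Ω`. -/
theorem integral_integral_mul_swap (hΩ : MeasurableSet Ω)
    (hR : ∀ x ∈ Ω, ∀ y ∈ Ω, ‖x - y‖ < R) (hN : Measurable N)
    (hNi : IntegrableOn N (Metric.ball 0 R)) {w φ : E d → ℂ} (hw : IntegrableOn w Ω)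
    (hφ : Continuous φ) (hs : HasCompactSupport φ) :
    ∫ x in Ω, (∫ y in Ω, N (x - y) * w y) * φ x
      = ∫ y in Ω, w y * ∫ x in Ω, N (x - y) * φ x := by
  obtain ⟨D, hD⟩ := hs.exists_bound_of_continuous hφ
  have hm : AEStronglyMeasurable (Function.uncurry fun x y => N (x - y) * w y * φ x)
      ((volume.restrict Ω).prod (volume.restrict Ω)) :=
    (aestronglyMeasurable_sub_mul hN hw.aestronglyMeasurable).mul
      (hφ.comp continuous_fst).aestronglyMeasurable
  have hI : Integrable (Function.uncurry fun x y => N (x - y) * w y * φ x)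
      ((volume.restrict Ω).prod (volume.restrict Ω)) := by
    refine ⟨hm, ?_⟩
    have hw' := hw.2
    have hN' := hNi.2
    rw [HasFiniteIntegral] at hw' hN' ⊢
    rw [lintegral_prod_symm _ hm.enorm]
    have hDe : ∀ x, ‖φ x‖ₑ ≤ ENNReal.ofReal D := fun x => by
      rw [← ofReal_norm]
      exact ENNReal.ofReal_le_ofReal (hD x)
    calc ∫⁻ y in Ω, ∫⁻ x in Ω, ‖N (x - y) * w y * φ x‖ₑ
        ≤ ∫⁻ y in Ω, (ENNReal.ofReal D * ∫⁻ z in Metric.ball 0 R, ‖N z‖ₑ) * ‖w y‖ₑ := by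
          refine setLIntegral_mono' hΩ fun y hy => ?_
          calc ∫⁻ x in Ω, ‖N (x - y) * w y * φ x‖ₑ
              ≤ ∫⁻ x in Ω, (ENNReal.ofReal D * ‖w y‖ₑ) * ‖N (x - y)‖ₑ := by
                refine lintegral_mono fun x => ?_
                rw [enorm_mul, enorm_mul, mul_comm, mul_comm ‖N (x - y)‖ₑ, ← mul_assoc]
                gcongr
                exact hDe x
            _ = (ENNReal.ofReal D * ‖w y‖ₑ) * ∫⁻ x in Ω, ‖N (x - y)‖ₑ :=
                lintegral_const_mul' _ _ (ENNReal.mul_ne_top ENNReal.ofReal_ne_top (by simp))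
            _ ≤ (ENNReal.ofReal D * ‖w y‖ₑ) * ∫⁻ z in Metric.ball 0 R, ‖N z‖ₑ :=
                mul_le_mul_right (lintegral_sub_right_le hR (fun z => ‖N z‖ₑ) hΩ hy) _
            _ = _ := by ring
      _ = (ENNReal.ofReal D * ∫⁻ z in Metric.ball 0 R, ‖N z‖ₑ) * ∫⁻ y in Ω, ‖w y‖ₑ :=
          lintegral_const_mul' _ _ (ENNReal.mul_ne_top ENNReal.ofReal_ne_top hN'.ne)
      _ < ⊤ := ENNReal.mul_lt_top (ENNReal.mul_lt_top ENNReal.ofReal_lt_top hN') hw'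
  simp only [← integral_mul_const, ← integral_const_mul]
  rw [integral_integral_swap hI]
  refine integral_congr_ae (ae_of_all _ fun y => ?_)
  refine integral_congr_ae (ae_of_all _ fun x => ?_)
  ring

end Fubini

section Gradient

variable {d : ℕ} {Ω : Set (E d)} {R : ℝ} {g g' : ℝ → ℂ} {β : E d → ℂ}

theorem IsWeaklySingularProfile.integrableOn_radial (h : IsWeaklySingularProfile d g g')
    (hd : 1 ≤ d) (R : ℝ) : IntegrableOn (fun z : E d => g ‖z‖) (Metric.ball 0 R) := by
  obtain ⟨C, -, hC⟩ := h.bound R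
  exact integrableOn_ball_of_norm_le hd h.measurable_radial.aestronglyMeasurable
    fun z hz hzR => (hC _ (norm_pos_iff.2 hz) hzR.le).1

theorem IsWeaklySingularProfile.integrableOn_radialPartial (h : IsWeaklySingularProfile d g g')
    (hd : 1 ≤ d) (i : Fin d) (R : ℝ) :
    IntegrableOn (radialPartial (d := d) g' i) (Metric.ball 0 R) := by
  obtain ⟨C, -, hC⟩ := h.bound R
  exact integrableOn_ball_of_norm_le hd (h.measurable_radialPartial i).aestronglyMeasurable
    fun z hz hzR => (norm_radialPartial_le i z).trans (hC _ (norm_pos_iff.2 hz) hzR.le).2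

theorem integrableOn_mul_of_bounded (hΩb : Bornology.IsBounded Ω)
    (hβ : AEStronglyMeasurable β (volume.restrict Ω)) {B : ℝ≥0}
    (hB : ∀ᵐ y ∂(volume.restrict Ω), ‖β y‖ₑ ≤ B) (u : L2 Ω) :
    IntegrableOn (fun y => β y * u y) Ω := by
  have : IsFiniteMeasure (volume.restrict Ω) := ⟨by simpa using hΩb.measure_lt_top⟩
  refine Integrable.bdd_mul (c := B) ((Lp.memLp u).integrable (by norm_num)) hβ ?_
  filter_upwards [hB] with y hy
  rw [enorm_le_coe] at hy
  exact_mod_cast hy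

/-- The weak derivatives of a potential are obtained by differentiating its kernel. -/
theorem IsWeaklySingularProfile.isWeakPartial (h : IsWeaklySingularProfile d g g') (hd : 1 ≤ d)
    (hΩ : MeasurableSet Ω) (hΩb : Bornology.IsBounded Ω)
    (hR : ∀ x ∈ Ω, ∀ y ∈ Ω, ‖x - y‖ < R)
    (hβ : AEStronglyMeasurable β (volume.restrict Ω)) {B : ℝ≥0}
    (hB : ∀ᵐ y ∂(volume.restrict Ω), ‖β y‖ₑ ≤ B) (i : Fin d) {u v v' : L2 Ω}
    (hv : ∀ᵐ x ∂(volume.restrict Ω), v x = ∫ y in Ω, g ‖x - y‖ * β y * u y)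
    (hv' : ∀ᵐ x ∂(volume.restrict Ω), v' x = ∫ y in Ω, radialPartial g' i (x - y) * β y * u y) :
    IsWeakPartial Ω i v v' := by
  intro φ hφ
  have hφ' : IsTest univ φ := ⟨hφ.smooth, hφ.compact, subset_univ _⟩
  have hw := integrableOn_mul_of_bounded hΩb hβ hB u
  have e1 : ∫ x in Ω, v x * partialD i φ x
      = ∫ x in Ω, (∫ y in Ω, g ‖x - y‖ * (β y * u y)) * partialD i φ x := by
    refine integral_congr_ae ?_
    filter_upwards [hv] with x hx
    simp only [hx, mul_assoc]
  have e2 : ∫ x in Ω, v' x * φ x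
      = ∫ x in Ω, (∫ y in Ω, radialPartial g' i (x - y) * (β y * u y)) * φ x := by
    refine integral_congr_ae ?_
    filter_upwards [hv'] with x hx
    simp only [hx, mul_assoc]
  rw [e1, e2, integral_integral_mul_swap (N := fun z => g ‖z‖) hΩ hR h.measurable_radial
      (h.integrableOn_radial hd R) hw (hφ.continuous_partialD i)
      (hφ.hasCompactSupport_partialD i),
    integral_integral_mul_swap hΩ hR (h.measurable_radialPartial i)
      (h.integrableOn_radialPartial hd i R) hw hφ.smooth.continuous hφ.compact,
    ← integral_neg]
  refine integral_congr_ae (ae_of_all _ fun y => ?_)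
  simp only
  -- As `φ` is supported in `Ω`, the inner integrals extend to the whole space, where the derivative
  -- moves to the kernel without boundary terms.
  rw [setIntegral_eq_integral_of_forall_compl_eq_zero (fun x hx => by
      rw [hφ.partialD_eq_zero i hx, mul_zero]),
    setIntegral_eq_integral_of_forall_compl_eq_zero (fun x hx => by
      rw [hφ.eq_zero hx, mul_zero]),
    h.integral_sub_mul_partialD hd i hφ' y, mul_neg]

/-- A map into `H¹(Ω)` from its components. -/
noncomputable def mapToH1 (V : L2 Ω →L[ℂ] L2 Ω) (W : Fin d → L2 Ω →L[ℂ] L2 Ω)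
    (hVW : ∀ u i, IsWeakPartial Ω i (V u) (W i u)) : L2 Ω →L[ℂ] H1 Ω :=
  ContinuousLinearMap.codRestrict
    ((WithLp.prodContinuousLinearEquiv 2 ℂ (L2 Ω)
        (PiLp 2 fun _ : Fin d => L2 Ω)).symm.toContinuousLinearMap.comp
      (V.prod ((PiLp.continuousLinearEquiv 2 ℂ fun _ : Fin d => L2 Ω).symm.toContinuousLinearMap.comp
        (ContinuousLinearMap.pi W)))) (H1 Ω) (fun u i => hVW u i)

theorem fnOf_mapToH1 (V : L2 Ω →L[ℂ] L2 Ω) (W : Fin d → L2 Ω →L[ℂ] L2 Ω)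
    (hVW : ∀ u i, IsWeakPartial Ω i (V u) (W i u)) (u : L2 Ω) :
    fnOf (mapToH1 V W hVW u) = V u := rfl

/-- The inclusion of `H¹(Ω)` in `L²(Ω)`. -/
noncomputable def inclH1 (Ω : Set (E d)) : H1 Ω →L[ℂ] L2 Ω :=
  (WithLp.fstL 2 ℂ (L2 Ω) (PiLp 2 fun _ : Fin d => L2 Ω)).comp (H1 Ω).subtypeL

end Gradient

/-! ### Laplace transforms as weakly singular profiles -/

section Laplace

variable {H : ℝ → ℂ} {M C : ℝ} {d : ℕ}

theorem integrableOn_exp_mul_pow (hd : 2 ≤ d) {r : ℝ} (hr : 0 < r) :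
    IntegrableOn (fun s : ℝ => Real.exp (-(r * s)) * s ^ ((d : ℝ) - 2)) (Ioi 0) ∧
      ∫ s in Ioi (0 : ℝ), Real.exp (-(r * s)) * s ^ ((d : ℝ) - 2)
        = Real.Gamma ((d : ℝ) - 1) * r ^ (1 - d : ℝ) := by
  have hd' : (2 : ℝ) ≤ d := by exact_mod_cast hd
  constructor
  · have := integrableOn_rpow_mul_exp_neg_mul_rpow (p := 1) (s := (d : ℝ) - 2) (b := r)
      (by linarith) one_pos hr
    refine this.congr_fun (fun s _ => ?_) measurableSet_Ioi
    simp only [Real.rpow_one]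
    rw [mul_comm, neg_mul]
  · have := Real.integral_rpow_mul_exp_neg_mul_Ioi (a := (d : ℝ) - 1) (r := r) (by linarith) hr
    rw [mul_comm, one_div, Real.inv_rpow hr.le, ← Real.rpow_neg hr.le, neg_sub] at this
    rw [← this]
    refine setIntegral_congr_fun measurableSet_Ioi fun s _ => ?_
    rw [mul_comm]
    congr 2
    ring

/-- A function that is integrable at `0` and at most `C s^(d-2)` at infinity has a Laplace
transform, which is `O(r^(1-d))` at `0`. -/
theorem integrableOn_exp_mul {W : ℝ → ℝ} (hd : 2 ≤ d) (hC : 0 ≤ C)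
    (hW0 : ∀ s, 0 < s → 0 ≤ W s) (hW : IntegrableOn W (Ioc 0 M))
    (hWm : AEStronglyMeasurable W (volume.restrict (Ioi 0)))
    (hWM : ∀ s, M < s → W s ≤ C * s ^ ((d : ℝ) - 2)) {r : ℝ} (hr : 0 < r) :
    IntegrableOn (fun s => Real.exp (-(r * s)) * W s) (Ioi 0) ∧
      ∫ s in Ioi (0 : ℝ), Real.exp (-(r * s)) * W s
        ≤ (∫ s in Ioc 0 M, W s) + C * (Real.Gamma ((d : ℝ) - 1) * r ^ (1 - d : ℝ)) := by
  obtain ⟨h1, h2⟩ := integrableOn_exp_mul_pow hd hr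
  have hWi : Integrable ((Ioc 0 M).indicator W) (volume.restrict (Ioi 0)) :=
    (hW.integrable_indicator measurableSet_Ioc).restrict
  have hdom : Integrable (fun s => (Ioc 0 M).indicator W s
      + C * (Real.exp (-(r * s)) * s ^ ((d : ℝ) - 2))) (volume.restrict (Ioi 0)) :=
    hWi.add (h1.const_mul C)
  have hle : ∀ s ∈ Ioi (0 : ℝ), Real.exp (-(r * s)) * W s ≤ (Ioc 0 M).indicator W s
      + C * (Real.exp (-(r * s)) * s ^ ((d : ℝ) - 2)) := by
    intro s hs
    have hs' : (0 : ℝ) < s := hs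
    have hp : 0 ≤ C * (Real.exp (-(r * s)) * s ^ ((d : ℝ) - 2)) := by positivity
    by_cases hsM : s ≤ M
    · rw [indicator_of_mem (show s ∈ Ioc 0 M from ⟨hs, hsM⟩)]
      have : Real.exp (-(r * s)) ≤ 1 := Real.exp_le_one_iff.2 (by nlinarith [mul_pos hr hs'])
      nlinarith [hW0 s hs, mul_le_of_le_one_left (hW0 s hs) this]
    · rw [indicator_of_notMem (fun h => hsM h.2), zero_add]
      calc _ ≤ Real.exp (-(r * s)) * (C * s ^ ((d : ℝ) - 2)) := by
            gcongr
            exact hWM s (not_le.1 hsM)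
        _ = _ := by ring
  have hint : IntegrableOn (fun s => Real.exp (-(r * s)) * W s) (Ioi 0) := by
    refine hdom.mono' (AEStronglyMeasurable.mul (Continuous.aestronglyMeasurable (by fun_prop))
      hWm) ?_
    filter_upwards [ae_restrict_mem measurableSet_Ioi] with s hs
    rw [Real.norm_of_nonneg (mul_nonneg (Real.exp_pos _).le (hW0 s hs))]
    exact hle s hs
  refine ⟨hint, ?_⟩
  calc _ ≤ ∫ s in Ioi (0 : ℝ), ((Ioc 0 M).indicator W s
      + C * (Real.exp (-(r * s)) * s ^ ((d : ℝ) - 2))) :=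
        setIntegral_mono_on hint hdom measurableSet_Ioi hle
    _ = _ := by
        rw [integral_add hWi (h1.const_mul C), integral_const_mul, h2,
          integral_indicator measurableSet_Ioc, Measure.restrict_restrict measurableSet_Ioc,
          inter_eq_left.2 Ioc_subset_Ioi_self]

/-- The Laplace transform. -/
noncomputable def laplace (H : ℝ → ℂ) (r : ℝ) : ℂ :=
  ∫ s in Ioi (0 : ℝ), (Real.exp (-(r * s)) : ℂ) * H s

theorem norm_exp_mul_le {r r₀ s : ℝ} (hs : 0 < s) (hr : r₀ ≤ r) (z : ℂ) :
    ‖(Real.exp (-(r * s)) : ℂ) * z‖ ≤ Real.exp (-(r₀ * s)) * ‖z‖ := by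
  rw [norm_mul, Complex.norm_real, Real.norm_of_nonneg (Real.exp_pos _).le]
  gcongr

theorem continuousOn_laplace (hHm : AEStronglyMeasurable H (volume.restrict (Ioi 0)))
    (hH : ∀ r, 0 < r → IntegrableOn (fun s => Real.exp (-(r * s)) * ‖H s‖) (Ioi 0)) :
    ContinuousOn (laplace H) (Ioi 0) := by
  intro r hr
  have hr' : (0 : ℝ) < r := hr
  refine ContinuousAt.continuousWithinAt ?_
  refine continuousAt_of_dominated (bound := fun s => Real.exp (-(r / 2 * s)) * ‖H s‖)
    (Eventually.of_forall fun ρ => AEStronglyMeasurable.mul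
      (Continuous.aestronglyMeasurable (by fun_prop)) hHm) ?_ (hH _ (by positivity)) ?_
  · filter_upwards [Ioi_mem_nhds (half_lt_self hr')] with ρ hρ
    filter_upwards [ae_restrict_mem measurableSet_Ioi] with s hs
    exact norm_exp_mul_le hs (le_of_lt hρ) _
  · exact ae_of_all _ fun s => by fun_prop

theorem hasDerivAt_laplace (hHm : AEStronglyMeasurable H (volume.restrict (Ioi 0)))
    (hH : ∀ r, 0 < r → IntegrableOn (fun s => Real.exp (-(r * s)) * ‖H s‖) (Ioi 0))
    (hsH : ∀ r, 0 < r → IntegrableOn (fun s => Real.exp (-(r * s)) * ‖(-s : ℂ) * H s‖) (Ioi 0))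
    {r : ℝ} (hr : 0 < r) :
    HasDerivAt (laplace H) (laplace (fun s => (-s : ℂ) * H s) r) r := by
  have hm : ∀ ρ : ℝ, AEStronglyMeasurable (fun s => (Real.exp (-(ρ * s)) : ℂ) * H s)
      (volume.restrict (Ioi 0)) := fun ρ =>
    AEStronglyMeasurable.mul (Continuous.aestronglyMeasurable (by fun_prop)) hHm
  refine (hasDerivAt_integral_of_dominated_loc_of_deriv_le
    (F := fun ρ s => (Real.exp (-(ρ * s)) : ℂ) * H s)
    (F' := fun ρ s => (Real.exp (-(ρ * s)) : ℂ) * ((-s : ℂ) * H s))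
    -- For `ρ > r / 2` the exponential is at most its value at `r / 2`, which dominates near `r`.
    (bound := fun s => Real.exp (-(r / 2 * s)) * ‖(-s : ℂ) * H s‖)
    (Ioi_mem_nhds (half_lt_self hr)) (Eventually.of_forall hm) ?_ ?_ ?_ (hsH _ (by positivity))
    ?_).2
  · refine (hH r hr).mono' (hm r) ?_
    filter_upwards [ae_restrict_mem measurableSet_Ioi] with s hs
    exact norm_exp_mul_le hs le_rfl _
  · exact AEStronglyMeasurable.mul (Continuous.aestronglyMeasurable (by fun_prop))
      (AEStronglyMeasurable.mul (Continuous.aestronglyMeasurable (by fun_prop)) hHm)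
  · filter_upwards [ae_restrict_mem measurableSet_Ioi] with s hs ρ hρ
    exact norm_exp_mul_le hs (le_of_lt hρ) _
  · refine ae_of_all _ fun s ρ _ => ?_
    have h1 : HasDerivAt (fun ρ : ℝ => Real.exp (-(ρ * s))) (Real.exp (-(ρ * s)) * -(1 * s)) ρ :=
      (((hasDerivAt_id ρ).mul_const s).neg).exp
    have h2 := (h1.ofReal_comp).mul_const (H s)
    refine h2.congr_deriv ?_
    push_cast
    ring

/-- `c e^{ikr} ∫₀^∞ e^{-rs} H(s) ds` is a weakly singular profile if `H` is integrable at `0` and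
`O(s^(d-3))` at infinity. -/
theorem isWeaklySingularProfile_laplace (hd : 2 ≤ d) (hC : 0 ≤ C)
    (hHm : AEStronglyMeasurable H (volume.restrict (Ioi 0)))
    (hH : IntegrableOn H (Ioc 0 M))
    (hHM : ∀ s, M < s → (1 + s) * ‖H s‖ ≤ C * s ^ ((d : ℝ) - 2)) (c k : ℂ) :
    IsWeaklySingularProfile d (fun r => c * Complex.exp (Complex.I * k * r) * laplace H r)
      (fun r => c * Complex.exp (Complex.I * k * r) *
        (Complex.I * k * laplace H r + laplace (fun s => (-s : ℂ) * H s) r)) := by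
  have hWm : AEStronglyMeasurable (fun s => (1 + s) * ‖H s‖) (volume.restrict (Ioi 0)) :=
    AEStronglyMeasurable.mul (Continuous.aestronglyMeasurable (by fun_prop)) hHm.norm
  have hW0 : ∀ s : ℝ, 0 < s → 0 ≤ (1 + s) * ‖H s‖ := fun s hs => by positivity
  have hW : IntegrableOn (fun s => (1 + s) * ‖H s‖) (Ioc 0 M) := by
    refine Integrable.bdd_mul (c := 1 + M) hH.norm (Continuous.aestronglyMeasurable (by fun_prop)) ?_
    filter_upwards [ae_restrict_mem measurableSet_Ioc] with s hs
    rw [Real.norm_of_nonneg (by linarith [hs.1])]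
    linarith [hs.2]
  have key := fun r (hr : (0 : ℝ) < r) => integrableOn_exp_mul hd hC hW0 hW hWm hHM hr
  have hsm : AEStronglyMeasurable (fun s : ℝ => (-s : ℂ) * H s) (volume.restrict (Ioi 0)) :=
    AEStronglyMeasurable.mul (Continuous.aestronglyMeasurable (by fun_prop)) hHm
  have b0 : ∀ s : ℝ, 0 < s → ‖H s‖ ≤ (1 + s) * ‖H s‖ := fun s hs => by
    nlinarith [norm_nonneg (H s)]
  have b1 : ∀ s : ℝ, 0 < s → ‖(-s : ℂ) * H s‖ ≤ (1 + s) * ‖H s‖ := fun s hs => by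
    rw [norm_mul, norm_neg, Complex.norm_real, Real.norm_of_nonneg hs.le]
    gcongr
    linarith
  -- The weight `1 + s` lets one estimate serve both `H` and the density `-s H` of the derivative.
  have gen : ∀ G : ℝ → ℂ, AEStronglyMeasurable G (volume.restrict (Ioi 0)) →
      (∀ s, 0 < s → ‖G s‖ ≤ (1 + s) * ‖H s‖) → ∀ r, 0 < r →
      IntegrableOn (fun s => Real.exp (-(r * s)) * ‖G s‖) (Ioi 0) ∧
      ‖laplace G r‖ ≤ ∫ s in Ioi (0 : ℝ), Real.exp (-(r * s)) * ((1 + s) * ‖H s‖) := by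
    intro G hGm hG r hr
    constructor
    · refine (key r hr).1.mono' (AEStronglyMeasurable.mul
        (Continuous.aestronglyMeasurable (by fun_prop)) hGm.norm) ?_
      filter_upwards [ae_restrict_mem measurableSet_Ioi] with s hs
      rw [Real.norm_of_nonneg (by positivity)]
      gcongr
      exact hG s hs
    · refine norm_integral_le_of_norm_le (key r hr).1 ?_
      filter_upwards [ae_restrict_mem measurableSet_Ioi] with s hs
      refine (norm_exp_mul_le hs le_rfl _).trans ?_
      gcongr
      exact hG s hs
  have i0 := fun r hr => (gen H hHm b0 r hr).1
  have i1 := fun r hr => (gen _ hsm b1 r hr).1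
  refine ⟨fun r hr => ?_, ?_, fun R => ?_⟩
  · have h1 : HasDerivAt (fun r : ℝ => Complex.exp (Complex.I * k * r))
        (Complex.exp (Complex.I * k * r) * (Complex.I * k * 1)) r :=
      ((HasDerivAt.ofReal_comp (hasDerivAt_id r)).const_mul (Complex.I * k)).cexp
    have h2 := (h1.const_mul c).mul (hasDerivAt_laplace hHm i0 i1 hr)
    refine HasDerivAt.congr_deriv h2 ?_
    ring
  · refine ContinuousOn.mul (Continuous.continuousOn (by fun_prop)) ?_
    exact (continuousOn_const.mul (continuousOn_laplace hHm i0)).add (continuousOn_laplace hsm i1)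
  · set c0 := ∫ s in Ioc 0 M, (1 + s) * ‖H s‖ with hc0
    have hc0p : 0 ≤ c0 := setIntegral_nonneg measurableSet_Ioc fun s hs => hW0 s hs.1
    set Γ := Real.Gamma ((d : ℝ) - 1) with hΓ
    have hd' : (2 : ℝ) ≤ d := by exact_mod_cast hd
    have hΓp : 0 ≤ Γ := (Real.Gamma_pos_of_pos (by linarith)).le
    rcases le_or_gt R 0 with hR | hR
    · exact ⟨0, le_rfl, fun r hr hrR => absurd hr (by linarith)⟩
    -- The contribution `c0` of small `s` is absorbed into the singular term, since `1 ≤ R^(d-1)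
    -- r^(1-d)` for `r ≤ R`.
    set D := c0 * R ^ ((d : ℝ) - 1) + C * Γ with hD
    have hDp : 0 ≤ D := by positivity
    have hint : ∀ r, 0 < r → r ≤ R →
        ∫ s in Ioi (0 : ℝ), Real.exp (-(r * s)) * ((1 + s) * ‖H s‖) ≤ D * r ^ (1 - d : ℝ) := by
      intro r hr hrR
      refine (key r hr).2.trans ?_
      have : 1 ≤ R ^ ((d : ℝ) - 1) * r ^ (1 - d : ℝ) := by
        rw [← neg_sub (d : ℝ) 1, Real.rpow_neg hr.le, ← div_eq_mul_inv, one_le_div (by positivity)]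
        exact Real.rpow_le_rpow hr.le hrR (by linarith)
      rw [hD, add_mul]
      nlinarith [mul_le_mul_of_nonneg_left this hc0p]
    have hexp : ∀ r, 0 < r → r ≤ R →
        ‖c * Complex.exp (Complex.I * k * r)‖ ≤ ‖c‖ * Real.exp (‖k‖ * R) := by
      intro r hr hrR
      rw [norm_mul]
      gcongr
      refine (Complex.norm_exp_le_exp_norm _).trans (Real.exp_le_exp.2 ?_)
      rw [norm_mul, norm_mul, Complex.norm_I, one_mul, Complex.norm_real, Real.norm_of_nonneg hr.le]
      gcongr
    refine ⟨‖c‖ * Real.exp (‖k‖ * R) * ((1 + ‖k‖) * D), by positivity, fun r hr hrR => ?_⟩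
    have e0 := (gen H hHm b0 r hr).2.trans (hint r hr hrR)
    have e1 := (gen _ hsm b1 r hr).2.trans (hint r hr hrR)
    have hX : 0 ≤ D * r ^ (1 - d : ℝ) := by positivity
    constructor
    · rw [norm_mul, mul_assoc (‖c‖ * _)]
      refine mul_le_mul (hexp r hr hrR) (e0.trans ?_) (norm_nonneg _) (by positivity)
      nlinarith [norm_nonneg k]
    · rw [norm_mul, mul_assoc (‖c‖ * _)]
      refine mul_le_mul (hexp r hr hrR) ((norm_add_le _ _).trans ?_) (norm_nonneg _)
        (by positivity)
      rw [norm_mul, norm_mul, Complex.norm_I, one_mul]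
      nlinarith [norm_nonneg k, mul_le_mul_of_nonneg_left e0 (norm_nonneg k)]

end Laplace

/-! ### The Helmholtz fundamental solution as a radial profile -/

section Helmholtz

/-- The factor multiplying `e^{-rs}` in Poisson's integral for the Hankel function. -/
noncomputable def poissonDensity (d : ℕ) (k : ℂ) (s : ℝ) : ℂ :=
  ((s ^ (((d : ℝ) - 3) / 2) : ℝ) : ℂ) * ((s : ℂ) / 2 - Complex.I * k) ^ (((d : ℂ) - 3) / 2)

variable {d : ℕ} {k : ℂ}

theorem measurable_poissonDensity : Measurable (poissonDensity d k) := by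
  unfold poissonDensity
  refine Measurable.mul (Complex.measurable_ofReal.comp (measurable_id.pow_const _)) ?_
  exact ((Complex.measurable_ofReal.div_const _).sub_const _).pow_const _

theorem norm_poissonDensity {s : ℝ} (hs : 0 < s) : ‖poissonDensity d k s‖ =
    s ^ (((d : ℝ) - 3) / 2) * ‖(s : ℂ) / 2 - Complex.I * k‖ ^ (((d : ℝ) - 3) / 2) := by
  have e : ((d : ℂ) - 3) / 2 = ((((d : ℝ) - 3) / 2 : ℝ) : ℂ) := by push_cast; rfl
  rw [poissonDensity, norm_mul, e, Complex.norm_cpow_real, Complex.norm_real,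
    Real.norm_of_nonneg (by positivity)]

/-- For such `s` the modulus of `s/2 - ik` lies between `s/4` and `s`. The upper bound is used if `d
≥ 3`. For `d = 2` the exponent is `-1/2`, and the lower bound costs the factor `4^(1/2) = 2`. -/
theorem norm_poissonDensity_le (hd : 2 ≤ d) {s : ℝ} (hs : 1 ≤ s) (hsk : 4 * ‖k‖ ≤ s) :
    (1 + s) * ‖poissonDensity d k s‖ ≤ 4 * s ^ ((d : ℝ) - 2) := by
  have hs0 : 0 < s := by linarith
  have hn : ‖(s : ℂ) / 2‖ = s / 2 := by
    rw [norm_div, Complex.norm_real, Real.norm_of_nonneg hs0.le]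
    norm_num
  have hk : ‖Complex.I * k‖ = ‖k‖ := by simp
  have hu : ‖(s : ℂ) / 2 - Complex.I * k‖ ≤ s := by
    refine (norm_sub_le _ _).trans ?_
    rw [hn, hk]
    linarith
  have hl : s / 4 ≤ ‖(s : ℂ) / 2 - Complex.I * k‖ := by
    refine le_trans ?_ (norm_sub_norm_le _ _)
    rw [hn, hk]
    linarith
  have key : ‖(s : ℂ) / 2 - Complex.I * k‖ ^ (((d : ℝ) - 3) / 2)
      ≤ 2 * s ^ (((d : ℝ) - 3) / 2) := by
    have hsp : 0 ≤ s ^ (((d : ℝ) - 3) / 2) := by positivity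
    rcases Nat.lt_or_ge d 3 with h3 | h3
    · have hd2 : d = 2 := by omega
      subst hd2
      refine (Real.rpow_le_rpow_of_nonpos (by positivity) hl (by norm_num)).trans ?_
      rw [Real.div_rpow hs0.le (by norm_num), div_eq_mul_inv, mul_comm,
        ← Real.rpow_neg (by norm_num)]
      have : (4 : ℝ) ^ (-((((2 : ℕ) : ℝ) - 3) / 2)) = 2 := by
        rw [show (4 : ℝ) = 2 ^ (2 : ℝ) by norm_num, ← Real.rpow_mul (by norm_num)]
        norm_num
      rw [this]
    · have h3' : (3 : ℝ) ≤ d := by exact_mod_cast h3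
      refine (Real.rpow_le_rpow (norm_nonneg _) hu (by linarith)).trans ?_
      linarith
  rw [norm_poissonDensity hs0]
  calc (1 + s) * (s ^ (((d : ℝ) - 3) / 2) * ‖(s : ℂ) / 2 - Complex.I * k‖ ^ (((d : ℝ) - 3) / 2))
      ≤ (2 * s) * (s ^ (((d : ℝ) - 3) / 2) * (2 * s ^ (((d : ℝ) - 3) / 2))) := by
        gcongr
        linarith
    _ = 4 * (s ^ (1 : ℝ) * s ^ (((d : ℝ) - 3) / 2) * s ^ (((d : ℝ) - 3) / 2)) := by
        rw [Real.rpow_one]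
        ring
    _ = 4 * s ^ ((d : ℝ) - 2) := by
        rw [← Real.rpow_add hs0, ← Real.rpow_add hs0]
        congr 2
        ring

theorem intervalIntegrable_abs_half_rpow (a b : ℝ) :
    IntervalIntegrable (fun t : ℝ => |t / 2| ^ (-(1 / 2) : ℝ)) volume a b := by
  have h : LocallyIntegrable (fun t : ℝ => |t / 2| ^ (-(1 / 2) : ℝ)) volume := by
    refine locallyIntegrable_of_norm_le_rpow (C := (2 : ℝ)⁻¹ ^ (-(1 / 2) : ℝ)) (α := 1 / 2)
      (by simp) (by simp; norm_num) (ae_of_all _ fun t => ?_)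
      (Measurable.aestronglyMeasurable (by fun_prop))
    rw [Real.norm_of_nonneg (by positivity), abs_div, div_eq_mul_inv, mul_comm,
      Real.mul_rpow (by positivity) (by positivity), Real.norm_eq_abs]
    simp
  exact (h.integrableOn_isCompact isCompact_uIcc).intervalIntegrable

/-- For `d ≥ 3` the density is bounded near `0`. For `d = 2` it may be singular at `s = 0` and where
`s/2 = ik`. Since `k ≠ 0`, these points are distinct, and splitting at `s = |k|` leaves one
integrable inverse square root on each side. -/
theorem integrableOn_poissonDensity (hd : 2 ≤ d) (hk : k ≠ 0 ∨ 3 ≤ d) {M : ℝ} (hM : 0 ≤ M) :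
    IntegrableOn (poissonDensity d k) (Ioc 0 M) := by
  have hm : AEStronglyMeasurable (poissonDensity d k) (volume.restrict (Ioc 0 M)) :=
    measurable_poissonDensity.aestronglyMeasurable
  have hik : ‖Complex.I * k‖ = ‖k‖ := by simp
  rcases Nat.lt_or_ge d 3 with h3 | h3
  · have hd2 : d = 2 := by omega
    subst hd2
    have hk0 : 0 < ‖k‖ := norm_pos_iff.2 (hk.resolve_right (by norm_num))
    have hp : (((2 : ℕ) : ℝ) - 3) / 2 = -(1 / 2) := by norm_num
    have i1 : IntegrableOn (fun s : ℝ => s ^ (-(1 / 2) : ℝ)) (Ioc 0 M) :=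
      (intervalIntegrable_iff_integrableOn_Ioc_of_le hM).1
        (intervalIntegral.intervalIntegrable_rpow' (by norm_num))
    have i2 : IntegrableOn (fun s : ℝ => |(s + 2 * k.im) / 2| ^ (-(1 / 2) : ℝ)) (Ioc 0 M) := by
      have := (intervalIntegrable_abs_half_rpow (0 + 2 * k.im) (M + 2 * k.im)).comp_add_right
        (2 * k.im)
      simp only [add_sub_cancel_right] at this
      exact (intervalIntegrable_iff_integrableOn_Ioc_of_le hM).1 this
    refine ((i1.const_mul ((‖k‖ / 2) ^ (-(1 / 2) : ℝ))).add
      (i2.const_mul (‖k‖ ^ (-(1 / 2) : ℝ)))).mono' hm ?_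
    -- At this point the real part of `s/2 - ik` vanishes and the power `0 ^ (-1/2)` takes the value
    -- `0`, so the majorant could fail there.
    have hne : ∀ᵐ s : ℝ ∂(volume.restrict (Ioc 0 M)), s ≠ -(2 * k.im) :=
      ae_restrict_of_ae (Measure.ae_ne volume _)
    filter_upwards [ae_restrict_mem measurableSet_Ioc, hne] with s hs hs'
    have hs0 : 0 < s := hs.1
    rw [norm_poissonDensity hs0, hp]
    simp only [Pi.add_apply]
    rcases lt_or_ge s ‖k‖ with hlt | hge
    · have hl : ‖k‖ / 2 ≤ ‖(s : ℂ) / 2 - Complex.I * k‖ := by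
        rw [norm_sub_rev]
        refine le_trans ?_ (norm_sub_norm_le _ _)
        rw [hik, norm_div, Complex.norm_real, Real.norm_of_nonneg hs0.le, Complex.norm_ofNat]
        linarith
      have := Real.rpow_le_rpow_of_nonpos (by positivity) hl
        (show (-(1 / 2) : ℝ) ≤ 0 by norm_num)
      calc _ ≤ s ^ (-(1 / 2) : ℝ) * (‖k‖ / 2) ^ (-(1 / 2) : ℝ) := by gcongr
        _ = (‖k‖ / 2) ^ (-(1 / 2) : ℝ) * s ^ (-(1 / 2) : ℝ) := mul_comm _ _
        _ ≤ _ := le_add_of_nonneg_right (by positivity)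
    · have hpos : 0 < |(s + 2 * k.im) / 2| := by
        rw [abs_pos]
        intro h0
        exact hs' (by linarith)
      have hl : |(s + 2 * k.im) / 2| ≤ ‖(s : ℂ) / 2 - Complex.I * k‖ := by
        refine le_trans (le_of_eq ?_) (Complex.abs_re_le_norm _)
        congr 1
        have : ((s : ℂ) / 2) = ((s / 2 : ℝ) : ℂ) := by push_cast; rfl
        rw [this]
        simp
        ring
      have h1 := Real.rpow_le_rpow_of_nonpos hpos hl (show (-(1 / 2) : ℝ) ≤ 0 by norm_num)
      have h2 := Real.rpow_le_rpow_of_nonpos hk0 hge (show (-(1 / 2) : ℝ) ≤ 0 by norm_num)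
      calc _ ≤ ‖k‖ ^ (-(1 / 2) : ℝ) * |(s + 2 * k.im) / 2| ^ (-(1 / 2) : ℝ) := by gcongr
        _ ≤ _ := le_add_of_nonneg_left (by positivity)
  · have h3' : (3 : ℝ) ≤ d := by exact_mod_cast h3
    have : IsFiniteMeasure (volume.restrict (Ioc 0 M)) := ⟨by simp⟩
    refine (integrable_const (M ^ (((d : ℝ) - 3) / 2) *
      (M / 2 + ‖k‖) ^ (((d : ℝ) - 3) / 2))).mono' hm ?_
    filter_upwards [ae_restrict_mem measurableSet_Ioc] with s hs
    have hs0 : 0 < s := hs.1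
    rw [norm_poissonDensity hs0]
    have hp : 0 ≤ ((d : ℝ) - 3) / 2 := by linarith
    have hu : ‖(s : ℂ) / 2 - Complex.I * k‖ ≤ M / 2 + ‖k‖ := by
      refine (norm_sub_le _ _).trans ?_
      rw [hik, norm_div, Complex.norm_real, Real.norm_of_nonneg hs0.le, Complex.norm_ofNat]
      linarith [hs.2]
    gcongr
    exact hs.2

/-- `G_k(x) = g(|x|)` for a weakly singular profile `g`. -/
theorem exists_profile_helmholtzG (hd : 1 ≤ d) (hk : k ≠ 0 ∨ 3 ≤ d) :
    ∃ g g' : ℝ → ℂ, IsWeaklySingularProfile d g g' ∧ ∀ x : E d, helmholtzG d k x = g ‖x‖ := by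
  rcases hd.eq_or_lt with rfl | hd2
  · refine ⟨fun r => Complex.I / (2 * k) * Complex.exp (Complex.I * k * r),
      fun r => Complex.I / (2 * k) * (Complex.exp (Complex.I * k * r) * (Complex.I * k)),
      ⟨fun r _ => ?_, Continuous.continuousOn (by fun_prop), fun R => ?_⟩, fun x => ?_⟩
    · have h1 : HasDerivAt (fun r : ℝ => Complex.exp (Complex.I * k * r))
          (Complex.exp (Complex.I * k * r) * (Complex.I * k * 1)) r :=
        ((HasDerivAt.ofReal_comp (hasDerivAt_id r)).const_mul (Complex.I * k)).cexp
      rw [mul_one] at h1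
      exact h1.const_mul _
    · refine ⟨‖Complex.I / (2 * k)‖ * (Real.exp (‖k‖ * R) * (1 + ‖k‖)), by positivity,
        fun r hr hrR => ?_⟩
      have hexp : ‖Complex.exp (Complex.I * k * r)‖ ≤ Real.exp (‖k‖ * R) := by
        refine (Complex.norm_exp_le_exp_norm _).trans (Real.exp_le_exp.2 ?_)
        rw [norm_mul, norm_mul, Complex.norm_I, one_mul, Complex.norm_real,
          Real.norm_of_nonneg hr.le]
        gcongr
      have hr1 : r ^ (1 - ((1 : ℕ) : ℝ)) = 1 := by simp
      rw [hr1, mul_one, norm_mul, norm_mul _ (_ * _), norm_mul (Complex.exp _), norm_mul Complex.I,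
        Complex.norm_I, one_mul]
      constructor
      · gcongr
        nlinarith [norm_nonneg k, Real.exp_pos (‖k‖ * R)]
      · gcongr
        linarith
    · simp [helmholtzG]
  · have hM : (0 : ℝ) ≤ max 1 (4 * ‖k‖) := le_trans zero_le_one (le_max_left _ _)
    have h := isWeaklySingularProfile_laplace (d := d) (H := poissonDensity d k)
      (M := max 1 (4 * ‖k‖)) (C := 4) hd2 (by norm_num)
      measurable_poissonDensity.aestronglyMeasurable
      (integrableOn_poissonDensity hd2 hk hM)
      (fun s hs => norm_poissonDensity_le hd2 ((le_max_left _ _).trans hs.le)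
        ((le_max_right _ _).trans hs.le))
      (1 / ((2 * (2 * Real.pi) ^ (((d : ℝ) - 1) / 2) * Real.Gamma (((d : ℝ) - 1) / 2) : ℝ) : ℂ)) k
    refine ⟨_, _, h, fun x => ?_⟩
    rw [helmholtzG, if_neg (by omega), laplace, one_div_mul_eq_div]
    congr 1
    refine integral_congr_ae (ae_of_all _ fun s => ?_)
    simp only [poissonDensity]
    push_cast
    ring

end Helmholtz

/-! ### The volume integral equation and its operator -/

section Equation

variable {d : ℕ} {Ω : Set (E d)} {k : ℂ} {a κ : E d → ℂ}

/-- Real test functions, viewed as complex ones, already suffice for the fundamental lemma of the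
calculus of variations. -/
theorem ae_eq_of_forall_isTest (hΩ : IsOpen Ω) (v w : L2 Ω)
    (h : ∀ φ : E d → ℂ, IsTest Ω φ → ∫ x in Ω, v x * φ x = ∫ x in Ω, w x * φ x) : v = w := by
  have hloc : LocallyIntegrableOn (fun x => v x - w x) Ω := by
    rw [locallyIntegrableOn_iff hΩ.isLocallyClosed]
    intro K hKΩ hK
    have hfin : IsFiniteMeasure ((volume.restrict Ω).restrict K) := ⟨by
      rw [Measure.restrict_apply_univ]
      exact (Measure.restrict_apply_le _ _).trans_lt hK.measure_lt_top⟩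
    have h1 : Integrable (fun x => v x - w x) ((volume.restrict Ω).restrict K) :=
      (((Lp.memLp v).sub (Lp.memLp w)).restrict K).integrable (by norm_num)
    rwa [Measure.restrict_restrict hK.measurableSet, inter_eq_left.2 hKΩ] at h1
  have key := hΩ.ae_eq_zero_of_integral_contDiff_smul_eq_zero hloc (fun ψ hψ hs hsupp => by
    have hts : tsupport (fun x => (ψ x : ℂ)) ⊆ tsupport ψ :=
      closure_mono fun x hx => by
        simpa using hx
    have hφ : IsTest Ω (fun x => (ψ x : ℂ)) :=
      { smooth := Complex.ofRealCLM.contDiff.comp hψ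
        compact := hs.comp_left Complex.ofReal_zero
        supp := hts.trans hsupp }
    have e := h _ hφ
    rw [← sub_eq_zero, ← integral_sub
      (integrable_mul_of_continuous v hφ.smooth.continuous hφ.compact)
      (integrable_mul_of_continuous w hφ.smooth.continuous hφ.compact)] at e
    rw [← setIntegral_eq_integral_of_forall_compl_eq_zero (s := Ω) (fun x hx => by
      have : ψ x = 0 := image_eq_zero_of_notMem_tsupport fun hh => hx (hsupp hh)
      rw [this, zero_smul]), ← e]
    refine integral_congr_ae (ae_of_all _ fun x => ?_)
    simp only [Complex.real_smul]
    ring)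
  refine Lp.ext ?_
  filter_upwards [(ae_restrict_iff' hΩ.measurableSet).2 key] with x hx
  exact sub_eq_zero.1 hx

theorem vioPairing_eq (ha : ∀ᵐ x : E d, a x = 1) {u : H1 Ω} {v : L2 Ω}
    (hv : ∀ᵐ x ∂(volume.restrict Ω), v x = ∫ y in Ω, vieKernel k κ x y * fnOf u y)
    (φ : E d → ℂ) : vioPairing Ω k a κ u φ = ∫ x in Ω, v x * φ x := by
  have h0 : ∀ (i : Fin d) (x : E d),
      ∫ y in Ω, helmholtzG d k (x - y) * (a y - 1) * gradOf u i y = 0 := by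
    intro i x
    rw [← integral_zero (E d) ℂ (μ := volume.restrict Ω)]
    refine integral_congr_ae ?_
    filter_upwards [ae_restrict_of_ae ha] with y hy
    rw [hy, sub_self, mul_zero, zero_mul]
  rw [vioPairing]
  simp only [h0, zero_mul, integral_zero, Finset.sum_const_zero, neg_zero, zero_add]
  refine integral_congr_ae ?_
  filter_upwards [hv] with x hx
  rw [hx]
  rfl

theorem solvesSecondKind_iff {K : E d → E d → ℂ} {A : L2 Ω →L[ℂ] L2 Ω}
    (hA : ∀ u : L2 Ω, ∀ᵐ x ∂(volume.restrict Ω), IntegrableOn (fun y => K x y * u y) Ω ∧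
      A u x = ∫ y in Ω, K x y * u y) (u f : L2 Ω) :
    u - A u = f ↔ SolvesSecondKind Ω K u f := by
  constructor
  · rintro rfl
    filter_upwards [hA u, Lp.coeFn_sub u (A u)] with x h1 h2
    exact ⟨h1.1, by rw [h2, Pi.sub_apply, h1.2]⟩
  · intro h
    refine Lp.ext ?_
    filter_upwards [h, hA u, Lp.coeFn_sub u (A u)] with x h0 h1 h2
    rw [h2, Pi.sub_apply, h1.2, h0.2]

theorem solvesVIE_iff (hΩ : IsOpen Ω) (ha : ∀ᵐ x : E d, a x = 1) {A : L2 Ω →L[ℂ] L2 Ω}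
    (hA : ∀ u : L2 Ω, ∀ᵐ x ∂(volume.restrict Ω),
      A u x = ∫ y in Ω, vieKernel k κ x y * u y) (u : H1 Ω) (f : L2 Ω) :
    SolvesVIE Ω k a κ u f ↔ fnOf u - A (fnOf u) = f := by
  have key : ∀ φ : E d → ℂ, IsTest Ω φ →
      (∫ x in Ω, fnOf u x * φ x) - vioPairing Ω k a κ u φ
        = ∫ x in Ω, (fnOf u - A (fnOf u) : L2 Ω) x * φ x := by
    intro φ hφ
    rw [vioPairing_eq ha (hA (fnOf u)), ← integral_sub
      (integrable_mul_of_continuous _ hφ.smooth.continuous hφ.compact)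
      (integrable_mul_of_continuous _ hφ.smooth.continuous hφ.compact)]
    refine integral_congr_ae ?_
    filter_upwards [Lp.coeFn_sub (fnOf u) (A (fnOf u))] with x hx
    rw [hx, Pi.sub_apply, sub_mul]
  constructor
  · intro h
    exact ae_eq_of_forall_isTest hΩ _ _ fun φ hφ => (key φ hφ).symm.trans (h φ hφ)
  · rintro rfl φ hφ
    exact key φ hφ

theorem exists_bound_contrast (hκ : MemLp κ ⊤ volume) (k : ℂ) (Ω : Set (E d)) :
    ∃ B : ℝ≥0, ∀ᵐ y ∂(volume.restrict Ω), ‖κ y ^ 2 - k ^ 2‖ₑ ≤ B := by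
  have hfin := hκ.2
  rw [eLpNorm_exponent_top] at hfin
  lift eLpNormEssSup κ volume to ℝ≥0 using hfin.ne with S hS
  refine ⟨S ^ 2 + ‖k‖₊ ^ 2, ae_restrict_of_ae ?_⟩
  filter_upwards [enorm_ae_le_eLpNormEssSup κ volume] with y hy
  rw [← hS] at hy
  refine enorm_sub_le.trans ?_
  rw [enorm_pow, enorm_pow]
  push_cast
  gcongr
  exact le_rfl

theorem isWeaklySingularKernel_vieKernel {g g' : ℝ → ℂ} {R : ℝ}
    (hg : IsWeaklySingularProfile d g g') (hG : ∀ x : E d, helmholtzG d k x = g ‖x‖)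
    (hd : 1 ≤ d) (hΩ : MeasurableSet Ω) (hR : ∀ x ∈ Ω, ∀ y ∈ Ω, ‖x - y‖ < R)
    (hβ : AEStronglyMeasurable (fun y => κ y ^ 2 - k ^ 2) (volume.restrict Ω)) {B : ℝ≥0}
    (hB : ∀ᵐ y ∂(volume.restrict Ω), ‖κ y ^ 2 - k ^ 2‖ₑ ≤ B) :
    IsWeaklySingularKernel Ω (vieKernel k κ) := by
  have hK : vieKernel k κ = fun x y => g ‖x - y‖ * (κ y ^ 2 - k ^ 2) := by
    ext x y
    rw [vieKernel, hG]
  rw [hK]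
  obtain ⟨C, hC, hb⟩ := hg.bound R
  refine ⟨aestronglyMeasurable_sub_mul (N := fun z => g ‖z‖) hg.measurable_radial hβ,
    -- The profile bound `r^(1-d)` corresponds to `γ = 1`.
    fun y _ => ?_, C * B, 1, one_pos, by exact_mod_cast hd, ?_⟩
  · refine ContinuousOn.mul ?_ continuousOn_const
    exact hg.continuousOn_radial.comp (continuous_id.sub continuous_const).continuousOn
      fun x hx => sub_ne_zero.2 hx.2
  · filter_upwards [ae_restrict_mem hΩ, hB] with y hy hBy x hx hxy
    rw [enorm_le_coe] at hBy
    have hBy' : ‖κ y ^ 2 - k ^ 2‖ ≤ B := by exact_mod_cast hBy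
    have h1 := (hb ‖x - y‖ (norm_pos_iff.2 (sub_ne_zero.2 hxy)) (hR x hx y hy).le).1
    rw [norm_mul, mul_right_comm]
    gcongr

/-- The potential with density `β u`, as a map to `H¹(Ω)`, and its approximability in `L²(Ω)`. -/
theorem exists_potential {g g' : ℝ → ℂ} {β : E d → ℂ} {R : ℝ}
    (hg : IsWeaklySingularProfile d g g') (hd : 1 ≤ d) (hΩ : MeasurableSet Ω)
    (hΩb : Bornology.IsBounded Ω) (hR : ∀ x ∈ Ω, ∀ y ∈ Ω, ‖x - y‖ < R)
    (hβ : AEStronglyMeasurable β (volume.restrict Ω)) {B : ℝ≥0}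
    (hB : ∀ᵐ y ∂(volume.restrict Ω), ‖β y‖ₑ ≤ B) :
    ∃ T : L2 Ω →L[ℂ] H1 Ω,
      (∀ u : L2 Ω, ∀ᵐ x ∂(volume.restrict Ω), IntegrableOn (fun y => g ‖x - y‖ * β y * u y) Ω ∧
        fnOf (T u) x = ∫ y in Ω, g ‖x - y‖ * β y * u y) ∧
      (1 - (inclH1 Ω).comp T).IsFredholm ∧ fredholmIndex (1 - (inclH1 Ω).comp T) = 0 := by
  have hop : ∀ N : E d → ℂ, Measurable N → IntegrableOn N (Metric.ball 0 R) →
      ∃ T : L2 Ω →L[ℂ] L2 Ω, ∀ u : L2 Ω, ∀ᵐ x ∂(volume.restrict Ω),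
        IntegrableOn (fun y => N (x - y) * β y * u y) Ω ∧
          T u x = ∫ y in Ω, N (x - y) * β y * u y := by
    intro N hN hNi
    have hfin : B * ∫⁻ z in Metric.ball 0 R, ‖N z‖ₑ ≠ ⊤ :=
      ENNReal.mul_ne_top ENNReal.coe_ne_top hNi.2.ne
    obtain ⟨T, -, hT⟩ := exists_convolutionOperator hΩ hR hN hβ hB
      (M := (B * ∫⁻ z in Metric.ball 0 R, ‖N z‖ₑ).toNNReal) (by rw [ENNReal.coe_toNNReal hfin])
    exact ⟨T, hT⟩
  obtain ⟨V, hV⟩ := hop (fun z => g ‖z‖) hg.measurable_radial (hg.integrableOn_radial hd R)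
  choose W hW using fun i : Fin d => hop (radialPartial g' i) (hg.measurable_radialPartial i)
    (hg.integrableOn_radialPartial hd i R)
  have hVW : ∀ u i, IsWeakPartial Ω i (V u) (W i u) := fun u i =>
    hg.isWeakPartial hd hΩ hΩb hR hβ hB i ((hV u).mono fun x hx => hx.2)
      ((hW i u).mono fun x hx => hx.2)
  have e : (inclH1 Ω).comp (mapToH1 V W hVW) = V := by
    ext1 u
    exact fnOf_mapToH1 V W hVW u
  -- Any `η < 1` would do, as `1 - (V - F)` only has to be invertible.
  obtain ⟨F, hF, hVF⟩ := exists_finiteRange_norm_sub_le (N := fun z => g ‖z‖) hΩ hΩb hR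
    hg.measurable_radial (hg.integrableOn_radial hd R) hβ hB hV (η := 1 / 2) (by norm_num)
  have hlt : ‖V - F‖ < 1 := hVF.trans_lt (by norm_num)
  have hfred := isFredholm_one_sub_of_norm_lt_one_of_hasFiniteRange hlt hF
  rw [sub_add_cancel] at hfred
  refine ⟨mapToH1 V W hVW, fun u => ?_, ?_⟩
  · simp only [fnOf_mapToH1]
    exact hV u
  · rw [e]
    exact hfred

end Equation

end AcousticVIE

/-! ### The main theorem -/

theorem theoremt (d : ℕ) (hd : 1 ≤ d) (Ω : Set (E d)) (hΩo : IsOpen Ω)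
    (hΩb : Bornology.IsBounded Ω) (k : ℂ) (hk : k ≠ 0 ∨ 3 ≤ d) (a κ : E d → ℂ)
    (ha : ∀ᵐ x : E d, a x = 1) (hκ : MemLp κ ⊤ volume) (hκΩ : ∀ᵐ x : E d, x ∉ Ω → κ x = k) :
    IsWeaklySingularKernel Ω (vieKernel k κ) ∧
    (∀ (u : H1 Ω) (f : L2 Ω),
      SolvesVIE Ω k a κ u f ↔ SolvesSecondKind Ω (vieKernel k κ) (fnOf u) f) ∧
    ∃ (A₀ : L2 Ω →L[ℂ] L2 Ω) (A₁ : H1 Ω →L[ℂ] H1 Ω),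
      (∀ u f : L2 Ω, u - A₀ u = f ↔ SolvesSecondKind Ω (vieKernel k κ) u f) ∧
      (∀ u : H1 Ω, fnOf (A₁ u) = A₀ (fnOf u)) ∧
      (∀ (u : H1 Ω) (φ : E d → ℂ), IsTest Ω φ →
        ∫ x in Ω, fnOf (A₁ u) x * φ x = vioPairing Ω k a κ u φ) ∧
      (1 - A₀).IsFredholm ∧ fredholmIndex (1 - A₀) = 0 ∧ FredholmAlternative (1 - A₀) ∧
      (1 - A₁).IsFredholm ∧ fredholmIndex (1 - A₁) = 0 ∧ FredholmAlternative (1 - A₁) := by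
  obtain ⟨g, g', hg, hG⟩ := exists_profile_helmholtzG hd hk
  obtain ⟨R, hR⟩ : ∃ R : ℝ, ∀ x ∈ Ω, ∀ y ∈ Ω, ‖x - y‖ < R := by
    obtain ⟨C, hC⟩ := Metric.isBounded_iff.1 hΩb
    exact ⟨C + 1, fun x hx y hy => by
      rw [← dist_eq_norm]
      exact (hC hx hy).trans_lt (lt_add_one C)⟩
  obtain ⟨B, hB⟩ := exists_bound_contrast hκ k Ω
  have hβ : AEStronglyMeasurable (fun y => κ y ^ 2 - k ^ 2) (volume.restrict Ω) :=
    ((hκ.1.pow 2).sub aestronglyMeasurable_const).restrict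
  obtain ⟨T, hT, hfred, hidx⟩ :=
    exists_potential hg hd hΩo.measurableSet hΩb hR hβ hB
  have hA : ∀ u : L2 Ω, ∀ᵐ x ∂(volume.restrict Ω),
      IntegrableOn (fun y => vieKernel k κ x y * u y) Ω ∧
        (inclH1 Ω).comp T u x = ∫ y in Ω, vieKernel k κ x y * u y := by
    intro u
    simp only [vieKernel, hG]
    exact hT u
  have hA' := fun u => (hA u).mono fun x hx => hx.2
  -- Swapping the factors of `(inclH1 Ω).comp T` turns the `L²` operator into the `H¹` operator.
  have hfred₁ := isFredholm_one_sub_comp_swap hfred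
  have hidx₁ := (fredholmIndex_one_sub_comp_swap (inclH1 Ω) T).trans hidx
  refine ⟨isWeaklySingularKernel_vieKernel hg hG hd hΩo.measurableSet hR hβ hB,
    fun u f => (solvesVIE_iff hΩo ha hA' u f).trans (solvesSecondKind_iff hA (fnOf u) f),
    (inclH1 Ω).comp T, T.comp (inclH1 Ω), solvesSecondKind_iff hA, fun u => rfl,
    fun u φ _ => (vioPairing_eq ha (hA' (fnOf u)) φ).symm, hfred, hidx,
    fredholmAlternative_of_isFredholm hfred hidx, hfred₁, hidx₁,
    fredholmAlternative_of_isFredholm hfred₁ hidx₁⟩
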